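/- Count-sketch. For $d,m\ge 1$ let $h:[d]\to[m]$ and $s:[d]\to\{+1,-1\}$ be random hash functions such that the $2d$ values $h(1),\dots,h(d),s(1),\dots,s(d)$ are mutually independent, each $h(j)$ uniform on $[m]$ and each $s(j)$ uniform on $\{+1,-1\}$. For $\mathbf p\in\mathbb R^d$ the count-sketch $\mathrm{CS}(\mathbf p)\in\mathbb R^m$ is given by $\mathrm{CS}(\mathbf p)_l=\sum_{j:\,h(j)=l}s(j)p_j$, $l\in[m]$. For $\mathbf u,\mathbf v\in\mathbb R^d$ (sketched with the same $h,s$) put $$\mathbf V_d=\frac1m\begin{bmatrix}\|\mathbf u\|^2 I_m&\langle \mathbf u,\mathbf v\rangle I_m\\ \langle \mathbf u,\mathbf v\rangle I_m&\|\mathbf v\|^2 I_m\end{bmatrix}\in\mathbb R^{2m\times 2m}.$$ Convergence. Since $\mathbf V_d$ and the dimension $2m$ depend on $d$, "$\begin{bmatrix}\mathrm{CS}(\mathbf u)\\ \mathrm{CS}(\mathbf v)\end{bmatrix}\overset{\mathcal D}{\to}\mathcal N(\mathbf 0,\mathbf V_d)$ as $d\to\infty$" means: $\mathbf V_d$ is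 positive definite for all large $d$, and the Lévy–Prokhorov distance (for the Euclidean norm on $\mathbb R^{2m}$) between the law of $\mathbf V_d^{-1/2}\begin{bmatrix}\mathrm{CS}(\mathbf u)\\ \mathrm{CS}(\mathbf v)\end{bmatrix}$ and the standard normal law $\mathcal N(\mathbf 0,I_{2m})$ tends to $0$. (For constant $m$ this is ordinary convergence in distribution of $\mathbf V_d^{-1/2}[\mathrm{CS}(\mathbf u);\mathrm{CS}(\mathbf v)]$ to $\mathcal N(\mathbf 0,I_{2m})$.) Theorem. Let $\delta>0$ and let $m=m(d)$ be positive integers with $m=o\!\left(d^{\delta/(2(2+\delta))}\right)$ as $d\to\infty$. For every $d$ let $h,s$ be random hash functions as above. (i) Let $\mathbf u=\mathbf u^{(d)},\mathbf v=\mathbf v^{(d)}\in\mathbb R^d$ be deterministic vectors such that, for some constants $C$ and $c>0$ and all large $d$, $$\frac1d\sum_{j=1}^d(u_j^2+v_j^2)^{\frac{2+\delta}2}\le C,\qquad \frac{\|\mathbf u\|^2\|\mathbf v\|^2-\langle\mathbf u,\mathbf v\rangle^2}{d^2}\ge c .$$ Then $\begin{bmatrix}\mathrm{CS}(\mathbf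 u)\\ \mathrm{CS}(\mathbf v)\end{bmatrix}\overset{\mathcal D}{\to}\mathcal N(\mathbf 0,\mathbf V_d)$ as $d\to\infty$. (ii) Let $(u_j,v_j)_{j\ge1}$ be i.i.d. random pairs of real numbers with $\mathrm E\big[(u_j^2+v_j^2)^{\frac{2+\delta}2}\big]<\infty$ and $\mathrm E[u_1v_1]^2<\mathrm E[u_1^2]\,\mathrm E[v_1^2]$. Then for almost every realization of $(u_j,v_j)_{j\ge1}$, with $\mathbf u=(u_1,\dots,u_d)$ and $\mathbf v=(v_1,\dots,v_d)$ held fixed at that realization (only $h,s$ being random), $\begin{bmatrix}\mathrm{CS}(\mathbf u)\\ \mathrm{CS}(\mathbf v)\end{bmatrix}\overset{\mathcal D}{\to}\mathcal N(\mathbf 0,\mathbf V_d)$ as $d\to\infty$. -/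

import Mathlib

open MeasureTheory ProbabilityTheory Filter Topology

namespace CountSketch

/-- The random hash data of a count-sketch from dimension `d` to `m` buckets: bucket hashes
`h j` uniform on the `m` buckets, sign hashes `s j` uniform on `{1, -1}`, all of them
(the `h j` and the `s j` together) mutually independent. -/
structure IsHashPair {Ω : Type*} [MeasurableSpace Ω] (P : Measure Ω) {d m : ℕ}
    (h : Fin d → Ω → Fin m) (s : Fin d → Ω → ℤˣ) : Prop where
  measurable_bucket : ∀ j, Measurable (h j)
  measurable_sign : ∀ j, Measurable (s j)
  bucket_uniform : ∀ j l, P.real {ω | h j ω = l} = 1 / (m : ℝ)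
  sign_uniform : ∀ j e, P.real {ω | s j ω = e} = 1 / 2
  indep_coord : iIndepFun (fun j ω => (h j ω, s j ω)) P
  indep_bucket_sign : ∀ j, IndepFun (h j) (s j) P

/-- The count-sketch `CS(p)`, with `CS(p)_l = ∑_{h(j) = l} s(j) p_j`. -/
noncomputable def sketch {d m : ℕ} (h : Fin d → Fin m) (s : Fin d → ℤˣ)
    (p : EuclideanSpace ℝ (Fin d)) : EuclideanSpace ℝ (Fin m) :=
  WithLp.toLp 2 fun l => ∑ j with h j = l, ((s j : ℤ) : ℝ) * p j

/-- The concatenation `(CS(u), CS(v))` of two sketches made with the same hash functions. -/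
noncomputable def sketchPair {d m : ℕ} (h : Fin d → Fin m) (s : Fin d → ℤˣ)
    (u v : EuclideanSpace ℝ (Fin d)) : EuclideanSpace ℝ (Fin m ⊕ Fin m) :=
  WithLp.toLp 2 (Sum.elim (sketch h s u) (sketch h s v))

/-- The `2m × 2m` matrix `V_d`, in `m × m` blocks. -/
noncomputable def covMatrix (m : ℕ) {d : ℕ} (u v : EuclideanSpace ℝ (Fin d)) :
    Matrix (Fin m ⊕ Fin m) (Fin m ⊕ Fin m) ℝ :=
  (1 / (m : ℝ)) • Matrix.fromBlocks
    ((‖u‖ ^ 2) • (1 : Matrix (Fin m) (Fin m) ℝ)) ((inner ℝ u v) • (1 : Matrix (Fin m) (Fin m) ℝ))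
    ((inner ℝ u v) • (1 : Matrix (Fin m) (Fin m) ℝ)) ((‖v‖ ^ 2) • (1 : Matrix (Fin m) (Fin m) ℝ))

open scoped MatrixOrder in
/-- `x ↦ V^{-1/2} x`, for a positive definite matrix `V`. -/
noncomputable def whiten {ι : Type*} [Fintype ι] [DecidableEq ι] (V : Matrix ι ι ℝ)
    (x : EuclideanSpace ℝ ι) : EuclideanSpace ℝ ι :=
  Matrix.toEuclideanCLM (𝕜 := ℝ) (CFC.sqrt V)⁻¹ x

/-- `μ_d → N(0, V_d)` as `d → ∞`, for laws `μ_d` on Euclidean spaces whose dimension may change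
with `d`: eventually `V_d` is positive definite, and the law of `V_d^{-1/2} X_d`, `X_d ∼ μ_d`,
approaches the standard normal law `N(0, I)` of the same space in the Lévy-Prokhorov metric (the
metric of convergence in distribution; in a fixed dimension this is
`V_d^{-1/2} X_d → N(0, I)` in distribution). -/
def AsymptoticallyNormal {ι : ℕ → Type*} [∀ d, Fintype (ι d)] [∀ d, DecidableEq (ι d)]
    (μ : ∀ d, Measure (EuclideanSpace ℝ (ι d))) (V : ∀ d, Matrix (ι d) (ι d) ℝ) : Prop :=
  (∀ᶠ d in atTop, (V d).PosDef) ∧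
  Tendsto (fun d => levyProkhorovEDist ((μ d).map (whiten (V d)))
    (stdGaussian (EuclideanSpace ℝ (ι d)))) atTop (𝓝 0)

end CountSketch

/-! After whitening, the sketch pair is a sum of independent vectors `√m σ_j (α_j e_{h(j)}, β_j
e_{h(j)})`. Here the vectors `α`, `β` are the orthonormalization of `u`, `v` by the inverse square
root of their `2 × 2` Gram matrix. Each summand has the covariance of a Gaussian of the form `(α_j
g, β_j g)`, so Lindeberg replacement applies. If `α_j² + β_j² ≤ ρ` for all `j`, then
`levyProkhorovEDist_sketch_le` bounds the distance to the normal law by `10 η` as soon as `16 m² ρ ≤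
η⁴`. The moment and determinant hypotheses give `ρ = O(d^{-δ/(2+δ)})`, so `m² ρ → 0` is exactly the
growth condition on `m`.

Three points keep the dependence on the dimension down to `m² ρ`.

One replacement is compared in `L²` of a Gaussian, without Taylor expansion of the test function.
Against a Gaussian of variance `s` in the direction `(α, β)`, the uniform mixture of `2m` shifts and
the enlarged Gaussian have explicit relative densities. With `a = (α² + β²)/s`, all terms of order
below `a⁴` cancel in the squared `L²` distance, leaving at most `2 m³ a⁴` (`shift_scale_defect_le`).
The difference of the densities has mean zero, so a test function enters only through its variance.
By the Gaussian Poincaré inequality a `K`-Lipschitz function contributes `K √s`, and this factor is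
what makes the total error `ρ/ε` and not `ρ/ε²`.

The variance `s` must be available in every direction. An initial smoothing by `ε² I` starts the
process, and a greedy order of replacement keeps the accumulated `2 × 2` covariance close to a
multiple of the identity (`abs_integral_sketch_sub_gaussian_le`). Hence `s` may be taken as `(ε² +
t)/4`, with `t` the trace replaced so far.

The errors are then of size `K m^{3/2} ρ r (ε² + t)^{-3/2}` with `r` the increment of `t`, and they
telescope to `64 K m^{3/2} ρ/ε`. Lipschitz test functions with `K = 1/η` and smoothing scale `ε =
η²/√(2m)` turn this into the Lévy-Prokhorov bound. Part (ii) follows from part (i) by the strong law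
of large numbers. -/

namespace CountSketch

/-! ### Gaussian Poincaré inequality -/

section Poincare

variable {E : Type*} [NormedAddCommGroup E] [InnerProductSpace ℝ E] [FiniteDimensional ℝ E]
  [MeasurableSpace E] [BorelSpace E]

lemma sq_intervalIntegral_le {φ : ℝ → ℝ} (hφ : Continuous φ) {L : ℝ} (hL : 0 < L) :
    (∫ t in (0 : ℝ)..L, φ t) ^ 2 ≤ L * ∫ t in (0 : ℝ)..L, φ t ^ 2 := by
  set A := ∫ t in (0 : ℝ)..L, φ t with hA
  -- The squared deviation of `φ` from its mean `A / L` integrates to something nonnegative, which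
  -- is the claim after expansion.
  have h0 : 0 ≤ ∫ t in (0 : ℝ)..L, (φ t - A / L) ^ 2 :=
    intervalIntegral.integral_nonneg hL.le fun t _ => sq_nonneg _
  have h1 : ∫ t in (0 : ℝ)..L, (φ t - A / L) ^ 2
      = (∫ t in (0 : ℝ)..L, φ t ^ 2) - A ^ 2 / L := by
    have : ∀ t, (φ t - A / L) ^ 2 = φ t ^ 2 - (2 * A / L) * φ t + (A / L) ^ 2 := fun t => by ring
    simp_rw [this]
    rw [intervalIntegral.integral_add, intervalIntegral.integral_sub,
      intervalIntegral.integral_const_mul, intervalIntegral.integral_const, ← hA]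
    · simp only [sub_zero, smul_eq_mul]; field_simp; ring
    all_goals apply Continuous.intervalIntegrable; fun_prop
  rw [h1] at h0
  have : A ^ 2 / L ≤ ∫ t in (0 : ℝ)..L, φ t ^ 2 := by linarith
  rw [div_le_iff₀ hL] at this
  linarith

lemma lintegral_sq_dual_stdGaussian (L : StrongDual ℝ E) :
    ∫⁻ y, ENNReal.ofReal (L y ^ 2) ∂(stdGaussian E) = ENNReal.ofReal (‖L‖ ^ 2) := by
  have hL : MemLp L 2 (stdGaussian E) := IsGaussian.memLp_dual _ L 2 (by simp)
  rw [← ofReal_integral_eq_lintegral_ofReal hL.integrable_sq (ae_of_all _ fun _ => sq_nonneg _),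
    ← variance_dual_stdGaussian L, variance_eq_integral hL.aemeasurable]
  simp [integral_strongDual_stdGaussian]

/-- Gaussian Poincaré inequality, in two-point form. -/
lemma lintegral_sq_sub_stdGaussian_le {f : E → ℝ} (hf : ContDiff ℝ 1 f) {K : NNReal}
    (hK : LipschitzWith K f) :
    ∫⁻ p, ENNReal.ofReal ((f p.2 - f p.1) ^ 2) ∂((stdGaussian E).prod (stdGaussian E))
      ≤ ENNReal.ofReal ((Real.pi / 2) ^ 2 * K ^ 2) := by
  set μ := stdGaussian E
  have hpi : 0 < Real.pi / 2 := by positivity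
  -- The first component of `R θ p` runs from `p.1` at `θ = 0` to `p.2` at `θ = π/2`, and its
  -- velocity is the second component. Under the product Gaussian, position and velocity are
  -- therefore independent standard Gaussians at every `θ`.
  obtain ⟨R, hRr, hR⟩ : ∃ R : ℝ → E × E → E × E,
      (∀ θ, R θ = ContinuousLinearMap.rotation θ) ∧ ∀ θ p, R θ p =
        (Real.cos θ • p.1 + Real.sin θ • p.2, -Real.sin θ • p.1 + Real.cos θ • p.2) :=
    ⟨fun θ => ContinuousLinearMap.rotation θ, fun _ => rfl,
      fun θ p => ContinuousLinearMap.rotation_apply θ p⟩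
  have hRc : Continuous fun q : (E × E) × ℝ => R q.2 q.1 := by
    simp_rw [hR]; fun_prop
  let D : E × E → ℝ := fun p => fderiv ℝ f p.1 p.2
  have hD : Continuous D :=
    ((hf.continuous_fderiv (by norm_num)).comp continuous_fst).clm_apply continuous_snd
  have hDR : Continuous fun q : (E × E) × ℝ => D (R q.2 q.1) := hD.comp hRc
  have hder : ∀ p : E × E, ∀ θ : ℝ, HasDerivAt (fun θ => f (R θ p).1) (D (R θ p)) θ := by
    intro p θ
    have h1 : HasDerivAt (fun θ => (R θ p).1) (R θ p).2 θ := by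
      simp_rw [hR]
      exact ((Real.hasDerivAt_cos θ).smul_const p.1).fun_add
        ((Real.hasDerivAt_sin θ).smul_const p.2)
    exact ((hf.differentiable (by norm_num)) _).hasFDerivAt.comp_hasDerivAt θ h1
  have hpt : ∀ p : E × E, (f p.2 - f p.1) ^ 2
      ≤ (Real.pi / 2) * ∫ θ in (0 : ℝ)..(Real.pi / 2), D (R θ p) ^ 2 := by
    intro p
    have hc : Continuous fun θ => D (R θ p) := hDR.comp (by fun_prop : Continuous fun θ : ℝ => (p, θ))
    have := intervalIntegral.integral_eq_sub_of_hasDerivAt (a := 0) (b := Real.pi / 2)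
      (fun θ _ => hder p θ) (hc.intervalIntegrable _ _)
    simp only [hR, Real.cos_pi_div_two, Real.sin_pi_div_two, Real.cos_zero, Real.sin_zero, zero_smul,
      one_smul, zero_add, add_zero] at this
    rw [← this]
    have h2 := sq_intervalIntegral_le hc hpi
    simpa only [hR] using h2
  have hpt2 : ∀ p : E × E, ENNReal.ofReal ((f p.2 - f p.1) ^ 2)
      ≤ ENNReal.ofReal (Real.pi / 2) *
        ∫⁻ θ in Set.Ioc 0 (Real.pi / 2), ENNReal.ofReal (D (R θ p) ^ 2) := by
    intro p
    have hc : Continuous fun θ => D (R θ p) := hDR.comp (by fun_prop : Continuous fun θ : ℝ => (p, θ))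
    rw [← ofReal_integral_eq_lintegral_ofReal, ← ENNReal.ofReal_mul hpi.le,
      ← intervalIntegral.integral_of_le hpi.le]
    · exact ENNReal.ofReal_le_ofReal (hpt p)
    · exact ((hc.pow 2).intervalIntegrable _ _).1
    · exact ae_of_all _ fun _ => sq_nonneg _
  -- Rotation invariance removes `θ`. For fixed position `x`, the Gaussian second moment of the
  -- functional `fderiv ℝ f x` is its squared norm, at most `K²`.
  have hslice : ∀ θ : ℝ, ∫⁻ p, ENNReal.ofReal (D (R θ p) ^ 2) ∂(μ.prod μ)
      ≤ ENNReal.ofReal (K ^ 2) := by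
    intro θ
    have hmap : (μ.prod μ).map (R θ) = μ.prod μ := by
      rw [hRr]; exact IsGaussian.map_rotation_eq_self (by simp [μ]) θ
    have hmR : Measurable (R θ) := by
      rw [hRr]; exact (ContinuousLinearMap.rotation θ).continuous.measurable
    have hmD : Measurable fun p => ENNReal.ofReal (D p ^ 2) := by
      exact (hD.measurable.pow_const 2).ennreal_ofReal
    calc ∫⁻ p, ENNReal.ofReal (D (R θ p) ^ 2) ∂(μ.prod μ)
        = ∫⁻ p, ENNReal.ofReal (D p ^ 2) ∂((μ.prod μ).map (R θ)) := by
          rw [lintegral_map hmD hmR]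
      _ = ∫⁻ x, ∫⁻ y, ENNReal.ofReal (D (x, y) ^ 2) ∂μ ∂μ := by
          rw [hmap, lintegral_prod _ hmD.aemeasurable]
      _ ≤ ∫⁻ x, ENNReal.ofReal (K ^ 2) ∂μ := by
          refine lintegral_mono fun x => ?_
          change ∫⁻ y, ENNReal.ofReal ((fderiv ℝ f x) y ^ 2) ∂μ ≤ _
          rw [lintegral_sq_dual_stdGaussian]
          gcongr
          exact norm_fderiv_le_of_lipschitz ℝ hK
      _ = _ := by simp
  calc ∫⁻ p, ENNReal.ofReal ((f p.2 - f p.1) ^ 2) ∂(μ.prod μ)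
      ≤ ∫⁻ p, ENNReal.ofReal (Real.pi / 2) *
        (∫⁻ θ in Set.Ioc 0 (Real.pi / 2), ENNReal.ofReal (D (R θ p) ^ 2)) ∂(μ.prod μ) :=
        lintegral_mono hpt2
    _ = ENNReal.ofReal (Real.pi / 2) * ∫⁻ p,
        (∫⁻ θ in Set.Ioc 0 (Real.pi / 2), ENNReal.ofReal (D (R θ p) ^ 2)) ∂(μ.prod μ) :=
        lintegral_const_mul' _ _ ENNReal.ofReal_ne_top
    _ = ENNReal.ofReal (Real.pi / 2) * ∫⁻ θ in Set.Ioc 0 (Real.pi / 2),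
        ∫⁻ p, ENNReal.ofReal (D (R θ p) ^ 2) ∂(μ.prod μ) := by
        rw [lintegral_lintegral_swap]
        exact (hDR.measurable.pow_const 2).ennreal_ofReal.aemeasurable
    _ ≤ ENNReal.ofReal (Real.pi / 2) * ∫⁻ θ in Set.Ioc 0 (Real.pi / 2), ENNReal.ofReal (K ^ 2) := by
        gcongr with θ
        exact hslice θ
    _ = _ := by
        rw [lintegral_const, Measure.restrict_apply_univ, Real.volume_Ioc, sub_zero,
          ← ENNReal.ofReal_mul (by positivity), ← ENNReal.ofReal_mul (by positivity)]
        congr 1; ring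

/-- A centred observable is nearly uncorrelated with a Lipschitz function of a Gaussian vector. -/
lemma abs_integral_mul_stdGaussian_le {f h : E → ℝ} (hf : ContDiff ℝ 1 f) {K : NNReal}
    (hK : LipschitzWith K f) {M : ℝ} (hM : ∀ x, |f x| ≤ M) (hh : MemLp h 2 (stdGaussian E))
    (hh0 : ∫ x, h x ∂(stdGaussian E) = 0) :
    |∫ x, f x * h x ∂(stdGaussian E)|
      ≤ 5 / 4 * K * √(∫ x, h x ^ 2 ∂(stdGaussian E)) := by
  set μ := stdGaussian E
  have hfm : AEStronglyMeasurable f μ := hf.continuous.aestronglyMeasurable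
  have hfi : MemLp f 2 μ := MemLp.of_bound hfm M (ae_of_all _ fun x => by simpa using hM x)
  set c := ∫ x, f x ∂μ
  have hfc : MemLp (fun x => f x - c) 2 μ := hfi.sub (memLp_const c)
  -- The two-point second moment is twice the variance, which halves `(π/2)²`. The bound `M` serves
  -- integrability only.
  have hvar : ∫ x, (f x - c) ^ 2 ∂μ ≤ Real.pi ^ 2 / 8 * K ^ 2 := by
    have h1 := lintegral_sq_sub_stdGaussian_le hf hK
    have hf1 : Integrable f μ := hfi.integrable (by norm_num)
    have hf2 : Integrable (fun x => f x ^ 2) μ := hfi.integrable_sq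
    have i1 : Integrable (fun p : E × E => f p.2 ^ 2) (μ.prod μ) := hf2.comp_snd μ
    have i2 : Integrable (fun p : E × E => f p.1 ^ 2) (μ.prod μ) := hf2.comp_fst μ
    have i3 : Integrable (fun p : E × E => f p.1 * f p.2) (μ.prod μ) := hf1.mul_prod hf1
    have i4 : Integrable (fun p : E × E => f p.2 ^ 2 + f p.1 ^ 2) (μ.prod μ) := i1.add i2
    have i5 : Integrable (fun x => f x ^ 2 - 2 * c * f x) μ := hf2.sub (hf1.const_mul _)
    have he : (fun p : E × E => (f p.2 - f p.1) ^ 2)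
        = fun p => f p.2 ^ 2 + f p.1 ^ 2 - 2 * (f p.1 * f p.2) := by ext p; ring
    have hint : Integrable (fun p : E × E => (f p.2 - f p.1) ^ 2) (μ.prod μ) := by
      rw [he]; exact i4.sub (i3.const_mul 2)
    have h2 : ∫ p, (f p.2 - f p.1) ^ 2 ∂(μ.prod μ) = 2 * (∫ x, f x ^ 2 ∂μ) - 2 * c ^ 2 := by
      rw [he, integral_sub i4 (i3.const_mul 2), integral_add i1 i2,
        integral_const_mul, integral_prod_mul, integral_fun_snd (μ := μ) (ν := μ) (fun x => f x ^ 2),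
        integral_fun_fst (μ := μ) (ν := μ) (fun x => f x ^ 2)]
      simp only [probReal_univ, one_smul]
      ring
    have h3 : ∫ x, (f x - c) ^ 2 ∂μ = (∫ x, f x ^ 2 ∂μ) - c ^ 2 := by
      have : ∀ x, (f x - c) ^ 2 = f x ^ 2 - 2 * c * f x + c ^ 2 := fun x => by ring
      simp_rw [this]
      rw [integral_add i5 (integrable_const _),
        integral_sub hf2 (hf1.const_mul _), integral_const_mul]
      simp only [integral_const, probReal_univ, one_smul]
      ring
    rw [← ofReal_integral_eq_lintegral_ofReal hint (ae_of_all _ fun _ => sq_nonneg _),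
      ENNReal.ofReal_le_ofReal_iff (by positivity), h2] at h1
    rw [h3]; nlinarith
  have hfh : ∫ x, f x * h x ∂μ = ∫ x, (f x - c) * h x ∂μ := by
    have i6 : Integrable (fun x => f x * h x) μ := hfi.integrable_mul hh
    have : ∀ x, (f x - c) * h x = f x * h x - c * h x := fun x => by ring
    simp_rw [this]
    rw [integral_sub i6 ((hh.integrable (by norm_num)).const_mul c),
      integral_const_mul, hh0]
    simp
  have hcs : |∫ x, (f x - c) * h x ∂μ| ≤ √(∫ x, (f x - c) ^ 2 ∂μ) * √(∫ x, h x ^ 2 ∂μ) := by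
    have h1 := integral_mul_le_Lp_mul_Lq_of_nonneg (μ := μ) Real.HolderConjugate.two_two
      (f := fun x => |f x - c|) (g := fun x => |h x|) (ae_of_all _ fun _ => abs_nonneg _)
      (ae_of_all _ fun _ => abs_nonneg _) (by simpa using! hfc.abs)
      (by simpa using! hh.abs)
    simp only [Real.rpow_two, sq_abs, ← Real.sqrt_eq_rpow] at h1
    refine le_trans (abs_integral_le_integral_abs) ?_
    simpa [abs_mul] using h1
  rw [hfh]
  refine hcs.trans ?_
  gcongr
  rw [Real.sqrt_le_iff]
  refine ⟨by positivity, hvar.trans ?_⟩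
  have hp : Real.pi ≤ 3.15 := Real.pi_lt_d2.le
  have : Real.pi ^ 2 / 8 ≤ (5 / 4) ^ 2 := by nlinarith [Real.pi_pos]
  nlinarith [sq_nonneg (K : ℝ)]

end Poincare

/-! ### Relative densities of shifted and rescaled Gaussians -/

section Density

variable {E : Type*} [NormedAddCommGroup E] [InnerProductSpace ℝ E]

variable (E) in
/-- The density of the standard Gaussian law. -/
noncomputable def stdGaussianPDF (x : E) : ℝ :=
  (2 * Real.pi) ^ (-(Module.finrank ℝ E : ℝ) / 2) * Real.exp (-‖x‖ ^ 2 / 2)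

lemma stdGaussianPDF_nonneg (x : E) : 0 ≤ stdGaussianPDF E x := by
  unfold stdGaussianPDF; positivity

lemma continuous_stdGaussianPDF : Continuous (stdGaussianPDF E) := by
  unfold stdGaussianPDF; fun_prop

variable [FiniteDimensional ℝ E] [MeasurableSpace E] [BorelSpace E]

lemma integral_stdGaussianPDF_mul_cexp (t : E) :
    ∫ x, (stdGaussianPDF E x : ℂ) * Complex.exp (inner ℝ x t * Complex.I)
      = Complex.exp (-‖t‖ ^ 2 / 2) := by
  have h := GaussianFourier.integral_cexp_neg_mul_sq_norm_add (V := E) (b := 1 / 2) (by norm_num)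
    Complex.I t
  have h2 : ∀ x : E, (stdGaussianPDF E x : ℂ) * Complex.exp (inner ℝ x t * Complex.I)
      = ((2 * Real.pi : ℝ) ^ (-(Module.finrank ℝ E : ℝ) / 2) : ℝ) *
        Complex.exp (-(1 / 2) * ‖x‖ ^ 2 + Complex.I * inner ℝ t x) := by
    intro x
    simp only [stdGaussianPDF, Complex.ofReal_mul, Complex.ofReal_exp, mul_assoc]
    rw [← Complex.exp_add, real_inner_comm]
    congr 2
    push_cast; ring
  simp_rw [h2]
  rw [integral_const_mul, h, ← mul_assoc]
  have h3 : (((2 * Real.pi : ℝ) ^ (-(Module.finrank ℝ E : ℝ) / 2) : ℝ) : ℂ) *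
      (Real.pi / (1 / 2) : ℂ) ^ ((Module.finrank ℝ E : ℂ) / 2) = 1 := by
    have : (Real.pi / (1 / 2) : ℂ) ^ ((Module.finrank ℝ E : ℂ) / 2)
        = (((2 * Real.pi : ℝ) ^ ((Module.finrank ℝ E : ℝ) / 2) : ℝ) : ℂ) := by
      rw [Complex.ofReal_cpow (by positivity)]
      push_cast; congr 1; ring
    rw [this, ← Complex.ofReal_mul, ← Real.rpow_add (by positivity)]
    simp [neg_div]
  rw [h3, one_mul]
  congr 1
  rw [Complex.I_sq]; ring

/-- The Fourier integral at `0` equals `1`, whereas the Bochner integral of a non-integrable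
function is `0` by convention. The same argument gives integrability of the exponentials below. -/
lemma integrable_stdGaussianPDF : Integrable (stdGaussianPDF E) := by
  have h := integral_stdGaussianPDF_mul_cexp (0 : E)
  have h1 : Integrable fun x : E => (stdGaussianPDF E x : ℂ) := by
    by_contra hc
    simp only [inner_zero_right, Complex.ofReal_zero, zero_mul, Complex.exp_zero, mul_one] at h
    rw [integral_undef hc] at h
    exact Complex.exp_ne_zero _ h.symm
  simpa using h1.re

lemma stdGaussian_eq_withDensity :
    stdGaussian E = volume.withDensity fun x => ENNReal.ofReal (stdGaussianPDF E x) := by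
  have : IsFiniteMeasure (volume.withDensity fun x => ENNReal.ofReal (stdGaussianPDF E x)) :=
    isFiniteMeasure_withDensity_ofReal integrable_stdGaussianPDF.2
  apply Measure.ext_of_charFun
  ext t
  rw [charFun_stdGaussian, charFun_apply, ← integral_stdGaussianPDF_mul_cexp,
    integral_withDensity_eq_integral_toReal_smul
      continuous_stdGaussianPDF.measurable.ennreal_ofReal (ae_of_all _ fun _ => by simp)]
  refine integral_congr_ae (ae_of_all _ fun x => ?_)
  simp [ENNReal.toReal_ofReal (stdGaussianPDF_nonneg x)]

lemma integral_stdGaussian_eq (f : E → ℝ) :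
    ∫ x, f x ∂(stdGaussian E) = ∫ x, stdGaussianPDF E x * f x := by
  rw [stdGaussian_eq_withDensity, integral_withDensity_eq_integral_toReal_smul
      continuous_stdGaussianPDF.measurable.ennreal_ofReal (ae_of_all _ fun _ => by simp)]
  refine integral_congr_ae (ae_of_all _ fun x => ?_)
  simp [ENNReal.toReal_ofReal (stdGaussianPDF_nonneg x)]

/-- Cameron-Martin formula. -/
lemma integral_stdGaussian_add (f : E → ℝ) (v : E) :
    ∫ x, f (x + v) ∂(stdGaussian E)
      = ∫ x, f x * Real.exp (inner ℝ x v - ‖v‖ ^ 2 / 2) ∂(stdGaussian E) := by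
  rw [integral_stdGaussian_eq, integral_stdGaussian_eq,
    ← integral_add_right_eq_self (fun x => stdGaussianPDF E x *
      (f x * Real.exp (inner ℝ x v - ‖v‖ ^ 2 / 2))) v]
  refine integral_congr_ae (ae_of_all _ fun x => ?_)
  simp only [stdGaussianPDF]
  have : Real.exp (-‖x‖ ^ 2 / 2)
      = Real.exp (-‖x + v‖ ^ 2 / 2) * Real.exp (inner ℝ (x + v) v - ‖v‖ ^ 2 / 2) := by
    rw [← Real.exp_add]
    congr 1
    rw [norm_add_sq_real, inner_add_left, real_inner_self_eq_norm_sq]; ring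
  rw [this]; ring

/-- Change of scale in a Gaussian integral. -/
lemma integral_stdGaussian_smul (f : E → ℝ) {c : ℝ} (hc : 0 < c) :
    ∫ x, f (c • x) ∂(stdGaussian E)
      = ∫ x, f x * ((c ^ Module.finrank ℝ E)⁻¹ *
          Real.exp (-(‖x‖ ^ 2 / 2) * ((c ^ 2)⁻¹ - 1))) ∂(stdGaussian E) := by
  rw [integral_stdGaussian_eq, integral_stdGaussian_eq]
  have h := Measure.integral_comp_smul (volume : Measure E) (fun x => stdGaussianPDF E x *
    (f x * ((c ^ Module.finrank ℝ E)⁻¹ * Real.exp (-(‖x‖ ^ 2 / 2) * ((c ^ 2)⁻¹ - 1))))) c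
  have hcn : 0 < c ^ Module.finrank ℝ E := by positivity
  rw [abs_of_pos (by positivity), smul_eq_mul, eq_inv_mul_iff_mul_eq₀ hcn.ne'] at h
  rw [← h, ← integral_const_mul]
  refine integral_congr_ae (ae_of_all _ fun x => ?_)
  simp only [stdGaussianPDF]
  have : Real.exp (-‖x‖ ^ 2 / 2)
      = Real.exp (-‖c • x‖ ^ 2 / 2) * Real.exp (-(‖c • x‖ ^ 2 / 2) * ((c ^ 2)⁻¹ - 1)) := by
    rw [← Real.exp_add]
    congr 1
    rw [norm_smul, Real.norm_eq_abs, abs_of_pos hc]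
    field_simp; ring
  rw [this]; field_simp

lemma integral_exp_inner_stdGaussian (v : E) :
    ∫ x, Real.exp (inner ℝ x v) ∂(stdGaussian E) = Real.exp (‖v‖ ^ 2 / 2) := by
  have h := integral_stdGaussian_add (fun _ => (1 : ℝ)) v
  simp only [integral_const, probReal_univ, smul_eq_mul, mul_one, one_mul, Real.exp_sub,
    div_eq_mul_inv _ (Real.exp _)] at h
  rw [integral_mul_const, ← div_eq_mul_inv, eq_div_iff (Real.exp_pos _).ne'] at h
  linarith

lemma integrable_exp_inner_stdGaussian (v : E) :
    Integrable (fun x => Real.exp (inner ℝ x v)) (stdGaussian E) := by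
  by_contra hc
  have h := integral_exp_inner_stdGaussian v
  rw [integral_undef hc] at h
  exact (Real.exp_pos _).ne h

lemma integral_exp_sq_stdGaussian {c : ℝ} (hc : 0 < c) :
    ∫ x, Real.exp (-(‖x‖ ^ 2 / 2) * ((c ^ 2)⁻¹ - 1)) ∂(stdGaussian E)
      = c ^ Module.finrank ℝ E := by
  have h := integral_stdGaussian_smul (E := E) (fun _ => (1 : ℝ)) hc
  simp only [integral_const, probReal_univ, smul_eq_mul, mul_one, one_mul] at h
  rw [integral_const_mul, eq_comm, inv_mul_eq_iff_eq_mul₀ (by positivity), mul_one] at h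
  exact h

lemma integrable_exp_sq_stdGaussian {c : ℝ} (hc : 0 < c) :
    Integrable (fun x => Real.exp (-(‖x‖ ^ 2 / 2) * ((c ^ 2)⁻¹ - 1))) (stdGaussian E) := by
  by_contra hn
  have h := integral_exp_sq_stdGaussian (E := E) hc
  rw [integral_undef hn] at h
  exact (pow_pos hc _).ne h

/-- The density of a shifted standard Gaussian law relative to the unshifted one. -/
noncomputable def shiftDensity (v x : E) : ℝ := Real.exp (inner ℝ x v - ‖v‖ ^ 2 / 2)

omit [FiniteDimensional ℝ E] [MeasurableSpace E] [BorelSpace E] in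
lemma shiftDensity_mul (v w x : E) :
    shiftDensity v x * shiftDensity w x
      = Real.exp (-(‖v‖ ^ 2 / 2 + ‖w‖ ^ 2 / 2)) * Real.exp (inner ℝ x (v + w)) := by
  rw [shiftDensity, shiftDensity, ← Real.exp_add, ← Real.exp_add, inner_add_right]
  congr 1; ring

lemma memLp_shiftDensity (v : E) : MemLp (shiftDensity v) 2 (stdGaussian E) := by
  rw [memLp_two_iff_integrable_sq]
  · simp_rw [pow_two, shiftDensity_mul]
    exact (integrable_exp_inner_stdGaussian _).const_mul _
  · refine Continuous.aestronglyMeasurable ?_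
    unfold shiftDensity; fun_prop

lemma integral_shiftDensity (v : E) : ∫ x, shiftDensity v x ∂(stdGaussian E) = 1 := by
  have := integral_stdGaussian_add (fun _ => (1 : ℝ)) v
  simpa [shiftDensity] using this.symm

lemma integral_shiftDensity_mul (v w : E) :
    ∫ x, shiftDensity v x * shiftDensity w x ∂(stdGaussian E) = Real.exp (inner ℝ v w) := by
  simp_rw [shiftDensity_mul]
  rw [integral_const_mul, integral_exp_inner_stdGaussian, ← Real.exp_add, norm_add_sq_real]
  congr 1; ring

variable (E) in
/-- The density of the Gaussian law with covariance `(1 + a) I` relative to the standard one. -/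
noncomputable def scaleDensity (a : ℝ) (x : E) : ℝ :=
  (√(1 + a) ^ Module.finrank ℝ E)⁻¹ * Real.exp (-(‖x‖ ^ 2 / 2) * ((√(1 + a) ^ 2)⁻¹ - 1))

lemma integral_comp_smul_eq_scaleDensity (f : E → ℝ) {a : ℝ} (ha : 0 < a) :
    ∫ x, f (√(1 + a) • x) ∂(stdGaussian E) = ∫ x, f x * scaleDensity E a x ∂(stdGaussian E) :=
  integral_stdGaussian_smul f (by positivity)

lemma integral_scaleDensity {a : ℝ} (ha : 0 < a) :
    ∫ x, scaleDensity E a x ∂(stdGaussian E) = 1 := by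
  have := integral_comp_smul_eq_scaleDensity (E := E) (fun _ => (1 : ℝ)) ha
  simpa using this.symm

omit [FiniteDimensional ℝ E] [MeasurableSpace E] [BorelSpace E] in
-- Squaring gives, up to a constant, the Gaussian weight of variance `(1 + a)/(1 - a)`. This keeps
-- the `L²` norm computable and is where `a < 1` is needed.
lemma scaleDensity_sq {a : ℝ} (ha : 0 < a) (ha1 : a < 1) (x : E) :
    scaleDensity E a x ^ 2 = ((1 + a) ^ Module.finrank ℝ E)⁻¹ *
      Real.exp (-(‖x‖ ^ 2 / 2) * ((√((1 + a) / (1 - a)) ^ 2)⁻¹ - 1)) := by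
  have h1 : 0 < 1 - a := by linarith
  rw [scaleDensity, mul_pow, inv_pow, ← pow_mul, mul_comm (Module.finrank ℝ E), pow_mul,
    Real.sq_sqrt (by positivity), ← Real.exp_nat_mul, Real.sq_sqrt (by positivity)]
  congr 2
  field_simp; push_cast; ring

lemma memLp_scaleDensity {a : ℝ} (ha : 0 < a) (ha1 : a < 1) :
    MemLp (scaleDensity E a) 2 (stdGaussian E) := by
  have h1 : 0 < 1 - a := by linarith
  rw [memLp_two_iff_integrable_sq]
  · simp_rw [scaleDensity_sq ha ha1]
    exact (integrable_exp_sq_stdGaussian (by positivity)).const_mul _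
  · refine Continuous.aestronglyMeasurable ?_
    unfold scaleDensity; fun_prop

lemma integral_scaleDensity_sq {a : ℝ} (ha : 0 < a) (ha1 : a < 1) :
    ∫ x, scaleDensity E a x ^ 2 ∂(stdGaussian E) = (√(1 - a ^ 2) ^ Module.finrank ℝ E)⁻¹ := by
  have h1 : 0 < 1 - a := by linarith
  simp_rw [scaleDensity_sq ha ha1]
  rw [integral_const_mul, integral_exp_sq_stdGaussian (by positivity), ← inv_pow, ← mul_pow,
    ← inv_pow]
  congr 1
  rw [← Real.sqrt_inv, eq_comm, Real.sqrt_eq_iff_mul_self_eq (by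
    rw [inv_nonneg]; nlinarith) (by positivity)]
  rw [mul_mul_mul_comm, Real.mul_self_sqrt (by positivity)]
  have : 1 - a ^ 2 = (1 - a) * (1 + a) := by ring
  rw [this]; field_simp

lemma integral_shiftDensity_mul_scaleDensity (v : E) {a : ℝ} (ha : 0 < a) :
    ∫ x, shiftDensity v x * scaleDensity E a x ∂(stdGaussian E) = Real.exp (a * ‖v‖ ^ 2 / 2) := by
  rw [← integral_comp_smul_eq_scaleDensity _ ha]
  have : ∀ x, shiftDensity v (√(1 + a) • x)
      = Real.exp (-(‖v‖ ^ 2 / 2)) * Real.exp (inner ℝ x (√(1 + a) • v)) := by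
    intro x
    rw [shiftDensity, ← Real.exp_add, inner_smul_left, inner_smul_right]
    congr 1; simp; ring
  simp_rw [this]
  rw [integral_const_mul, integral_exp_inner_stdGaussian, ← Real.exp_add, norm_smul, mul_pow,
    Real.norm_eq_abs, sq_abs, Real.sq_sqrt (by positivity)]
  congr 1; ring

/-- Comparison, for a smooth Lipschitz function, of a Gaussian vector perturbed by a uniform choice
among finitely many shifts with an independent Gaussian perturbation. -/
lemma abs_sum_shift_sub_scale_le {κ : Type*} [Fintype κ] [Nonempty κ] (v : κ → E) {a : ℝ}
    (ha : 0 < a) (ha1 : a < 1) {f : E → ℝ} (hf : ContDiff ℝ 1 f) {K : NNReal}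
    (hK : LipschitzWith K f) {M : ℝ} (hM : ∀ x, |f x| ≤ M) :
    |(Fintype.card κ : ℝ)⁻¹ * ∑ k, ∫ x, f (x + v k) ∂(stdGaussian E)
        - ∫ x, f (√(1 + a) • x) ∂(stdGaussian E)|
      ≤ 5 / 4 * K * √((Fintype.card κ : ℝ)⁻¹ ^ 2 * (∑ k, ∑ l, Real.exp (inner ℝ (v k) (v l)))
          - 2 * ((Fintype.card κ : ℝ)⁻¹ * ∑ k, Real.exp (a * ‖v k‖ ^ 2 / 2))
          + (√(1 - a ^ 2) ^ Module.finrank ℝ E)⁻¹) := by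
  set μ := stdGaussian E
  set N : ℝ := (Fintype.card κ : ℝ)⁻¹
  have hN : N * Fintype.card κ = 1 := inv_mul_cancel₀ (by simp)
  let S : E → ℝ := fun x => N * ∑ k, shiftDensity (v k) x
  have hS : MemLp S 2 μ := (memLp_finsetSum _ fun k _ => memLp_shiftDensity (v k)).const_mul N
  have hG : MemLp (scaleDensity E a) 2 μ := memLp_scaleDensity ha ha1
  -- `h` is the difference of the two densities relative to `μ`. It has mean zero, and the
  -- expression under the root in the claim is its squared `L²` norm, expanded as a square.
  let h : E → ℝ := fun x => S x - scaleDensity E a x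
  have hh : MemLp h 2 μ := hS.sub hG
  have hfi : MemLp f 2 μ :=
    MemLp.of_bound hf.continuous.aestronglyMeasurable M (ae_of_all _ fun x => by simpa using hM x)
  have iS : ∀ g : E → ℝ, MemLp g 2 μ → ∫ x, g x * S x ∂μ
      = N * ∑ k, ∫ x, g x * shiftDensity (v k) x ∂μ := by
    intro g hg
    have : ∀ x, g x * S x = N * ∑ k, g x * shiftDensity (v k) x := fun x => by
      simp only [S, Finset.mul_sum]; refine Finset.sum_congr rfl fun k _ => by ring
    simp_rw [this]
    rw [integral_const_mul, integral_finsetSum]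
    exact fun k _ => hg.integrable_mul (memLp_shiftDensity (v k))
  have h1 : MemLp (fun _ : E => (1 : ℝ)) 2 μ := memLp_const 1
  have hh0 : ∫ x, h x ∂μ = 0 := by
    have e := iS _ h1
    simp only [one_mul, integral_shiftDensity, μ, Finset.sum_const, Finset.card_univ,
      nsmul_eq_mul, mul_one, hN] at e
    rw [integral_sub (hS.integrable (by norm_num)) (hG.integrable (by norm_num)), e,
      integral_scaleDensity ha, sub_self]
  have i1 : Integrable (fun x => f x * S x) μ := hfi.integrable_mul hS
  have i2 : Integrable (fun x => f x * scaleDensity E a x) μ := hfi.integrable_mul hG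
  have hfh : ∫ x, f x * h x ∂μ = N * ∑ k, ∫ x, f (x + v k) ∂μ - ∫ x, f (√(1 + a) • x) ∂μ := by
    simp only [h, mul_sub]
    rw [integral_sub i1 i2, iS f hfi, integral_comp_smul_eq_scaleDensity f ha]
    simp_rw [μ, integral_stdGaussian_add f, shiftDensity]
  have i3 : Integrable (fun x => S x * S x) μ := hS.integrable_mul hS
  have i4 : Integrable (fun x => scaleDensity E a x * S x) μ := hG.integrable_mul hS
  have i5 : Integrable (fun x => scaleDensity E a x ^ 2) μ := hG.integrable_sq
  have i6 : Integrable (fun x => S x * S x - 2 * (scaleDensity E a x * S x)) μ :=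
    i3.sub (i4.const_mul 2)
  have hh2 : ∫ x, h x ^ 2 ∂μ = N ^ 2 * (∑ k, ∑ l, Real.exp (inner ℝ (v k) (v l)))
          - 2 * (N * ∑ k, Real.exp (a * ‖v k‖ ^ 2 / 2))
          + (√(1 - a ^ 2) ^ Module.finrank ℝ E)⁻¹ := by
    have : ∀ x, h x ^ 2 = S x * S x - 2 * (scaleDensity E a x * S x) + scaleDensity E a x ^ 2 :=
      fun x => by simp only [h]; ring
    simp_rw [this]
    rw [integral_add i6 i5, integral_sub i3 (i4.const_mul 2), integral_const_mul,
      integral_scaleDensity_sq ha ha1, iS _ hG, iS _ hS]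
    congr 2
    · have e : ∀ k, ∫ x, S x * shiftDensity (v k) x ∂μ
          = N * ∑ l, Real.exp (inner ℝ (v k) (v l)) := fun k => by
        simp_rw [mul_comm (S _)]
        rw [iS _ (memLp_shiftDensity (v k))]
        simp_rw [μ, integral_shiftDensity_mul]
      simp_rw [e]
      rw [← Finset.mul_sum]
      ring
    · simp_rw [mul_comm (scaleDensity E a _), μ, integral_shiftDensity_mul_scaleDensity _ ha]
  rw [← hfh, ← hh2]
  exact abs_integral_mul_stdGaussian_le hf hK hM hh hh0

end Density

/-! ### One signed basis vector against one Gaussian -/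

lemma cosh_sub_one_le {x : ℝ} (hx0 : 0 ≤ x) (hx : x ≤ 1 / 2) :
    (Real.exp x + Real.exp (-x)) / 2 ≤ 1 + x ^ 2 / 2 + x ^ 4 / 8 := by
  have h1 := Real.exp_bound' hx0 (by linarith) (n := 4) (by norm_num)
  have h2 := (abs_le.1 (Real.exp_bound (x := -x) (by rw [abs_neg, abs_of_nonneg hx0]; linarith) (n := 4) (by norm_num))).2
  simp [Finset.sum_range_succ, Nat.factorial, abs_of_nonneg hx0] at h1 h2
  nlinarith [pow_nonneg hx0 4]

lemma one_div_sqrt_one_sub_sq_pow_le {a : ℝ} (ha0 : 0 ≤ a) (m : ℕ) (hm : 0 < m)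
    (ha : m * a ≤ 1 / 2) :
    (√(1 - a ^ 2) ^ m)⁻¹ ≤ 1 + m * a ^ 2 / 2 + 3 / 2 * m ^ 2 * a ^ 4 := by
  have hm1 : (1 : ℝ) ≤ m := by exact_mod_cast hm
  have ha1 : a ≤ 1 / 2 := by nlinarith
  have h1 : 0 < 1 - a ^ 2 := by nlinarith
  -- This is `(1 - y)⁻¹ ≤ exp (y + y²)` for `y = a² ≤ 1/4`, after taking a square root.
  have h2 : (√(1 - a ^ 2))⁻¹ ≤ Real.exp ((a ^ 2 + a ^ 4) / 2) := by
    rw [← Real.sqrt_inv, Real.sqrt_le_left (Real.exp_pos _).le, ← Real.exp_nat_mul]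
    have e : ((2 : ℕ) : ℝ) * ((a ^ 2 + a ^ 4) / 2) = a ^ 2 + a ^ 4 := by push_cast; ring
    have hq := Real.quadratic_le_exp_of_nonneg (x := a ^ 2 + a ^ 4) (by positivity)
    rw [e, inv_le_iff_one_le_mul₀ h1]
    have hy2 : a ^ 2 ≤ 1 / 4 := by nlinarith
    have h4 : 0 ≤ a ^ 4 := by positivity
    have : 1 ≤ (1 + (a ^ 2 + a ^ 4) + (a ^ 2 + a ^ 4) ^ 2 / 2) * (1 - a ^ 2) := by
      nlinarith [mul_nonneg h4 (sub_nonneg.2 hy2), mul_nonneg (mul_nonneg h4 h4) h1.le,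
        mul_nonneg (mul_nonneg h4 (sq_nonneg a)) h1.le]
    exact this.trans (by gcongr)
  have h3 : (√(1 - a ^ 2) ^ m)⁻¹ ≤ Real.exp (m * ((a ^ 2 + a ^ 4) / 2)) := by
    rw [← inv_pow, Real.exp_nat_mul]
    gcongr
  refine h3.trans ?_
  have hz : 0 ≤ m * ((a ^ 2 + a ^ 4) / 2) := by positivity
  have h4 : a ^ 4 ≤ a ^ 2 := by nlinarith [sq_nonneg a]
  have h5 : m * ((a ^ 2 + a ^ 4) / 2) ≤ m * a ^ 2 := by nlinarith
  have h6 := Real.exp_bound' hz (by nlinarith) (n := 2) (by norm_num)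
  simp [Finset.sum_range_succ, Nat.factorial] at h6
  have h7 : (m * ((a ^ 2 + a ^ 4) / 2)) ^ 2 ≤ (m * a ^ 2) ^ 2 := by gcongr
  have h8 : m * a ^ 4 ≤ m ^ 2 * a ^ 4 := by gcongr; nlinarith
  nlinarith

/-- The constants `1 - 2 + 1` cancel, and so do the second-order terms `m a²/2 - m a² + m a²/2`,
because the covariances match. Symmetry of the signs removes odd orders. The remainders `m³a⁴/8` and
`3m²a⁴/2` fit into `2m³a⁴`. -/
lemma shift_scale_defect_le {a : ℝ} (ha0 : 0 ≤ a) (m : ℕ) (hm : 0 < m) (ha : m * a ≤ 1 / 2) :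
    1 - (m : ℝ)⁻¹ + (m : ℝ)⁻¹ * ((Real.exp (m * a) + Real.exp (-(m * a))) / 2)
      - 2 * Real.exp (a * (m * a) / 2) + (√(1 - a ^ 2) ^ m)⁻¹
      ≤ 2 * m ^ 3 * a ^ 4 := by
  have hm1 : (1 : ℝ) ≤ m := by exact_mod_cast hm
  have h1 := cosh_sub_one_le (x := m * a) (by positivity) ha
  have h2 := one_div_sqrt_one_sub_sq_pow_le ha0 m hm ha
  have h3 := Real.add_one_le_exp (a * (m * a) / 2)
  have h4 : (m : ℝ)⁻¹ * ((Real.exp (m * a) + Real.exp (-(m * a))) / 2)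
      ≤ (m : ℝ)⁻¹ * (1 + (m * a) ^ 2 / 2 + (m * a) ^ 4 / 8) := by gcongr
  have h5 : (m : ℝ)⁻¹ * (1 + (m * a) ^ 2 / 2 + (m * a) ^ 4 / 8)
      = (m : ℝ)⁻¹ + m * a ^ 2 / 2 + m ^ 3 * a ^ 4 / 8 := by field_simp
  have h6 : (m : ℝ) ^ 2 * a ^ 4 ≤ m ^ 3 * a ^ 4 := by gcongr; norm_num
  have h7 : a * (m * a) = m * a ^ 2 := by ring
  rw [h7] at h3 ⊢
  nlinarith

/-- Replacing a random signed basis vector of length `√(m a)` by a Gaussian vector with the same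
covariance `a I`. -/
lemma abs_signed_basis_sub_gaussian_le {m : ℕ} (hm : 0 < m) {a : ℝ} (ha0 : 0 < a)
    (ha : m * a ≤ 1 / 2) {f : EuclideanSpace ℝ (Fin m) → ℝ} (hf : ContDiff ℝ 1 f) {K : NNReal}
    (hK : LipschitzWith K f) {M : ℝ} (hM : ∀ x, |f x| ≤ M) :
    |(m * 2 : ℝ)⁻¹ * ∑ k : Fin m × ℤˣ,
          ∫ x, f (x + (√(m * a) * ((k.2 : ℤ) : ℝ)) • EuclideanSpace.single k.1 (1 : ℝ))
            ∂(stdGaussian (EuclideanSpace ℝ (Fin m)))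
        - ∫ x, f (√(1 + a) • x) ∂(stdGaussian (EuclideanSpace ℝ (Fin m)))|
      ≤ 2 * K * √(m ^ 3) * a ^ 2 := by
  have hm1 : (1 : ℝ) ≤ m := by exact_mod_cast hm
  have : NeZero m := ⟨hm.ne'⟩
  set v : Fin m × ℤˣ → EuclideanSpace ℝ (Fin m) := fun k =>
    (√(m * a) * ((k.2 : ℤ) : ℝ)) • EuclideanSpace.single k.1 (1 : ℝ) with hv
  have h := abs_sum_shift_sub_scale_le v ha0 (by nlinarith) hf hK hM
  have hsgn : ∀ e : ℤˣ, ((e : ℤ) : ℝ) ^ 2 = 1 := fun e => by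
    rcases Int.units_eq_one_or e with rfl | rfl <;> simp
  have hcard : (Fintype.card (Fin m × ℤˣ) : ℝ) = m * 2 := by simp
  have hma : √(m * a) ^ 2 = m * a := Real.sq_sqrt (by positivity)
  have hinner : ∀ k l : Fin m × ℤˣ, (inner ℝ (v k) (v l) : ℝ)
      = if k.1 = l.1 then m * a * (((k.2 : ℤ) : ℝ) * ((l.2 : ℤ) : ℝ)) else 0 := by
    intro k l
    simp only [hv, inner_smul_left, inner_smul_right, EuclideanSpace.inner_single_left]
    by_cases hkl : k.1 = l.1
    · rw [if_pos hkl]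
      simp only [hkl, PiLp.single_apply]
      generalize √(m * a) = b at hma ⊢
      simp only [Real.ringHom_apply, map_one, if_true, mul_one]
      linear_combination (((k.2 : ℤ) : ℝ) * ((l.2 : ℤ) : ℝ)) * hma
    · simp [hkl]
  have hnorm : ∀ k, ‖v k‖ ^ 2 = m * a := fun k => by
    rw [← real_inner_self_eq_norm_sq, hinner, if_pos rfl, ← pow_two, hsgn, mul_one]
  -- Vectors in different buckets are orthogonal and contribute `1` each, `2(m - 1)` in all; the two
  -- in the same bucket have inner product `±m a`.
  have hrow : ∀ k, ∑ l, Real.exp (inner ℝ (v k) (v l))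
      = 2 * (m - 1) + (Real.exp (m * a) + Real.exp (-(m * a))) := by
    intro k
    simp_rw [hinner]
    rw [Fintype.sum_prod_type, ← Finset.add_sum_erase _ _ (Finset.mem_univ k.1)]
    have h1 : ∀ l ∈ Finset.univ.erase k.1, ∑ e : ℤˣ, Real.exp (if k.1 = l then
        m * a * (((k.2 : ℤ) : ℝ) * ((e : ℤ) : ℝ)) else 0) = 2 := by
      intro l hl
      simp [(Finset.ne_of_mem_erase hl).symm]
    simp only [] at h1 ⊢
    rw [Finset.sum_congr rfl h1]
    have hu : ∀ g : ℤˣ → ℝ, ∑ e, g e = g 1 + g (-1) := fun g => by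
      rw [show (Finset.univ : Finset ℤˣ) = {1, -1} from rfl]; simp
    have : ((m - 1 : ℕ) : ℝ) = m - 1 := by rw [Nat.cast_sub hm]; simp
    rw [hu]
    rcases Int.units_eq_one_or k.2 with h2 | h2 <;> simp [h2, this] <;> ring
  rw [hcard] at h
  simp only [hrow, hnorm, Finset.sum_const, Finset.card_univ, nsmul_eq_mul, hcard,
    finrank_euclideanSpace, Fintype.card_fin] at h
  refine h.trans ?_
  have hd := shift_scale_defect_le ha0.le m hm ha
  have e : ((m : ℝ) * 2)⁻¹ ^ 2 * (m * 2 * (2 * (m - 1) + (Real.exp (m * a) + Real.exp (-(m * a)))))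
        - 2 * (((m : ℝ) * 2)⁻¹ * (m * 2 * Real.exp (a * (m * a) / 2))) + (√(1 - a ^ 2) ^ m)⁻¹
      = 1 - (m : ℝ)⁻¹ + (m : ℝ)⁻¹ * ((Real.exp (m * a) + Real.exp (-(m * a))) / 2)
      - 2 * Real.exp (a * (m * a) / 2) + (√(1 - a ^ 2) ^ m)⁻¹ := by
    field_simp
  rw [e]
  -- `8/5 ≥ √2` is chosen so that its product with the Poincaré constant `5/4` is `2`.
  have h3 : √(2 * m ^ 3 * a ^ 4) ≤ 8 / 5 * (√(m ^ 3) * a ^ 2) := by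
    rw [Real.sqrt_le_left (by positivity), mul_pow, mul_pow, Real.sq_sqrt (by positivity)]
    have : 0 ≤ (m : ℝ) ^ 3 * a ^ 4 := by positivity
    nlinarith
  calc 5 / 4 * (K : ℝ) * √_ ≤ 5 / 4 * K * (8 / 5 * (√(m ^ 3) * a ^ 2)) := by
        gcongr
        exact (Real.sqrt_le_sqrt hd).trans h3
    _ = _ := by ring

/-! ### Test functions against convolutions -/

section Convolution

variable {E : Type*} [NormedAddCommGroup E] [SecondCountableTopology E] [MeasurableSpace E]
  [BorelSpace E]

omit [SecondCountableTopology E] in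
lemma integrable_of_continuous_of_bounded (μ : Measure E) [IsFiniteMeasure μ] {f : E → ℝ}
    (hf : Continuous f) {M : ℝ} (hM : ∀ x, |f x| ≤ M) : Integrable f μ :=
  Integrable.of_bound hf.aestronglyMeasurable M (ae_of_all _ fun x => by simpa using hM x)

lemma integral_conv_of_bounded (μ ν : Measure E) [IsProbabilityMeasure μ] [IsProbabilityMeasure ν]
    {f : E → ℝ} (hf : Continuous f) {M : ℝ} (hM : ∀ x, |f x| ≤ M) :
    ∫ x, f x ∂(μ ∗ ν) = ∫ x, ∫ y, f (x + y) ∂ν ∂μ :=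
  integral_conv (integrable_of_continuous_of_bounded _ hf hM)

/-- Conditioning on the common independent summand `κ` translates the test function. A bound uniform
over translates therefore allows all other summands to be ignored. -/
lemma abs_integral_conv_sub_le (κ μ ν : Measure E) [IsProbabilityMeasure κ]
    [IsProbabilityMeasure μ] [IsProbabilityMeasure ν] {f : E → ℝ} (hf : Continuous f) {M : ℝ}
    (hM : ∀ x, |f x| ≤ M) {B : ℝ}
    (hB : ∀ y, |∫ z, f (y + z) ∂μ - ∫ z, f (y + z) ∂ν| ≤ B) :
    |∫ x, f x ∂(κ ∗ μ) - ∫ x, f x ∂(κ ∗ ν)| ≤ B := by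
  have key : ∀ (η : Measure E) [IsProbabilityMeasure η],
      Integrable (fun y => ∫ z, f (y + z) ∂η) κ := by
    intro η _
    have hi : Integrable (fun p : E × E => f (p.1 + p.2)) (κ.prod η) :=
      Integrable.of_bound (by fun_prop) M (ae_of_all _ fun x => by simpa using hM _)
    exact hi.integral_prod_left
  rw [integral_conv_of_bounded κ μ hf hM, integral_conv_of_bounded κ ν hf hM,
    ← integral_sub (key μ) (key ν)]
  have := norm_integral_le_of_norm_le_const (μ := κ)
    (f := fun y => ∫ z, f (y + z) ∂μ - ∫ z, f (y + z) ∂ν) (ae_of_all _ hB)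
  simpa using this

end Convolution

/-! ### Gaussians with block covariance and a single replacement -/

section BlockGaussian

variable {m : ℕ}

/-- The map `x ↦ (α x, β x)`. -/
noncomputable def embed (m : ℕ) (α β : ℝ) :
    EuclideanSpace ℝ (Fin m) →L[ℝ] EuclideanSpace ℝ (Fin m ⊕ Fin m) :=
  LinearMap.toContinuousLinearMap
    { toFun := fun x => WithLp.toLp 2 (Sum.elim (fun l => α * x l) (fun l => β * x l))
      map_add' := fun x y => by
        ext i; rcases i with i | i <;> simp [mul_add]
      map_smul' := fun c x => by
        ext i; rcases i with i | i <;> simp <;> ring }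

@[simp] lemma embed_inl (α β : ℝ) (x : EuclideanSpace ℝ (Fin m)) (l : Fin m) :
    embed m α β x (Sum.inl l) = α * x l := rfl

@[simp] lemma embed_inr (α β : ℝ) (x : EuclideanSpace ℝ (Fin m)) (l : Fin m) :
    embed m α β x (Sum.inr l) = β * x l := rfl

lemma norm_sq_embed (α β : ℝ) (x : EuclideanSpace ℝ (Fin m)) :
    ‖embed m α β x‖ ^ 2 = (α ^ 2 + β ^ 2) * ‖x‖ ^ 2 := by
  rw [EuclideanSpace.real_norm_sq_eq, EuclideanSpace.real_norm_sq_eq, Fintype.sum_sum_type]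
  simp only [embed_inl, embed_inr, mul_pow, ← Finset.mul_sum, add_mul]

lemma smul_embed (c α β : ℝ) (x : EuclideanSpace ℝ (Fin m)) :
    c • embed m α β x = embed m (c * α) (c * β) x := by
  ext i; rcases i with i | i <;> simp [mul_assoc]

lemma inner_embed (α β : ℝ) (x : EuclideanSpace ℝ (Fin m))
    (z : EuclideanSpace ℝ (Fin m ⊕ Fin m)) :
    (inner ℝ (embed m α β x) z : ℝ) = inner ℝ x
      (WithLp.toLp 2 fun l => α * z (Sum.inl l) + β * z (Sum.inr l) : EuclideanSpace ℝ (Fin m)) := by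
  simp only [PiLp.inner_apply, Fintype.sum_sum_type, embed_inl, embed_inr, ← Finset.sum_add_distrib]
  refine Finset.sum_congr rfl fun l _ => ?_
  simp only [RCLike.inner_apply, conj_trivial]
  ring

/-- The matrix with `2 × 2` blocks that are multiples of the identity. -/
noncomputable def blockCov (m : ℕ) (p q t : ℝ) : Matrix (Fin m ⊕ Fin m) (Fin m ⊕ Fin m) ℝ :=
  Matrix.fromBlocks (p • (1 : Matrix (Fin m) (Fin m) ℝ)) (q • (1 : Matrix (Fin m) (Fin m) ℝ))
    (q • (1 : Matrix (Fin m) (Fin m) ℝ)) (t • (1 : Matrix (Fin m) (Fin m) ℝ))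

/-- Nonnegativity of the binary quadratic form `p x² + 2 q x y + t y²`. -/
def NonnegForm (p q t : ℝ) : Prop := ∀ x y : ℝ, 0 ≤ p * x ^ 2 + 2 * q * x * y + t * y ^ 2

lemma blockCov_mulVec (p q t : ℝ) (x : Fin m ⊕ Fin m → ℝ) :
    (blockCov m p q t).mulVec x = Sum.elim
      (fun l => p * x (Sum.inl l) + q * x (Sum.inr l))
      (fun l => q * x (Sum.inl l) + t * x (Sum.inr l)) := by
  conv_lhs => rw [← Sum.elim_comp_inl_inr x]
  rw [blockCov, Matrix.fromBlocks_mulVec]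
  simp only [Matrix.smul_mulVec, Matrix.one_mulVec, Sum.elim_comp_inl_inr]
  congr 1

lemma dotProduct_blockCov (p q t : ℝ) (x : Fin m ⊕ Fin m → ℝ) :
    x ⬝ᵥ (blockCov m p q t).mulVec x = ∑ l, (p * x (Sum.inl l) ^ 2
      + 2 * q * x (Sum.inl l) * x (Sum.inr l) + t * x (Sum.inr l) ^ 2) := by
  rw [blockCov_mulVec, dotProduct, Fintype.sum_sum_type, ← Finset.sum_add_distrib]
  refine Finset.sum_congr rfl fun l _ => ?_
  simp only [Sum.elim_inl, Sum.elim_inr]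
  ring

lemma isHermitian_blockCov (p q t : ℝ) : (blockCov m p q t).IsHermitian := by
  rw [blockCov, Matrix.isHermitian_fromBlocks_iff]
  refine ⟨?_, ?_, ?_, ?_⟩ <;> simp [Matrix.IsHermitian]

lemma NonnegForm.posSemidef {p q t : ℝ} (h : NonnegForm p q t) :
    (blockCov m p q t).PosSemidef := by
  refine Matrix.PosSemidef.of_dotProduct_mulVec_nonneg (isHermitian_blockCov p q t) fun x => ?_
  rw [star_trivial, dotProduct_blockCov]
  exact Finset.sum_nonneg fun l _ => h _ _

lemma NonnegForm.add {p q t p' q' t' : ℝ} (h : NonnegForm p q t) (h' : NonnegForm p' q' t') :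
    NonnegForm (p + p') (q + q') (t + t') := fun x y => by
  have := h x y; have := h' x y; nlinarith

lemma nonnegForm_sq (α β : ℝ) : NonnegForm (α ^ 2) (α * β) (β ^ 2) := fun x y => by
  have := sq_nonneg (α * x + β * y); nlinarith

/-- The centred Gaussian law with covariance `blockCov m p q t`. -/
noncomputable def blockGaussian (m : ℕ) (p q t : ℝ) :
    Measure (EuclideanSpace ℝ (Fin m ⊕ Fin m)) :=
  multivariateGaussian 0 (blockCov m p q t)

instance (p q t : ℝ) : IsProbabilityMeasure (blockGaussian m p q t) := by
  unfold blockGaussian; infer_instance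

lemma charFun_blockGaussian {p q t : ℝ} (h : NonnegForm p q t)
    (z : EuclideanSpace ℝ (Fin m ⊕ Fin m)) :
    charFun (blockGaussian m p q t) z = Complex.exp (((-(∑ l, (p * z (Sum.inl l) ^ 2
      + 2 * q * z (Sum.inl l) * z (Sum.inr l) + t * z (Sum.inr l) ^ 2)) / 2 : ℝ)) : ℂ) := by
  rw [blockGaussian, charFun_multivariateGaussian h.posSemidef, dotProduct_blockCov]
  congr 1
  simp [neg_div]

lemma blockGaussian_conv {p q t p' q' t' : ℝ} (h : NonnegForm p q t) (h' : NonnegForm p' q' t') :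
    blockGaussian m p q t ∗ blockGaussian m p' q' t'
      = blockGaussian m (p + p') (q + q') (t + t') := by
  apply Measure.ext_of_charFun
  ext z
  rw [charFun_conv, charFun_blockGaussian h, charFun_blockGaussian h',
    charFun_blockGaussian (h.add h'), ← Complex.exp_add, ← Complex.ofReal_add]
  congr 2
  rw [← add_div, ← neg_add, ← Finset.sum_add_distrib]
  congr 2
  refine Finset.sum_congr rfl fun l _ => ?_
  ring

lemma map_embed_stdGaussian (α β : ℝ) :
    (stdGaussian (EuclideanSpace ℝ (Fin m))).map (embed m α β)
      = blockGaussian m (α ^ 2) (α * β) (β ^ 2) := by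
  have : IsProbabilityMeasure ((stdGaussian (EuclideanSpace ℝ (Fin m))).map (embed m α β)) :=
    Measure.isProbabilityMeasure_map (by fun_prop)
  apply Measure.ext_of_charFun
  ext z
  rw [charFun_apply, integral_map (by fun_prop) (by fun_prop)]
  simp_rw [inner_embed]
  rw [← charFun_apply, charFun_stdGaussian, charFun_blockGaussian (nonnegForm_sq α β)]
  congr 1
  rw [← Complex.ofReal_pow, EuclideanSpace.real_norm_sq_eq]
  push_cast
  congr 2
  refine Finset.sum_congr rfl fun l _ => ?_
  ring

lemma blockGaussian_one : blockGaussian m 1 0 1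
    = stdGaussian (EuclideanSpace ℝ (Fin m ⊕ Fin m)) := by
  rw [blockGaussian, blockCov, zero_smul, one_smul, Matrix.fromBlocks_one,
    multivariateGaussian_zero_one]

/-- The law `ν` is that of `√m σ (α e_l, β e_l)` with uniform independent `l` and `σ = ±1`. -/
def IsSketchStep (ν : Measure (EuclideanSpace ℝ (Fin m ⊕ Fin m))) (α β : ℝ) : Prop :=
  ∀ g : EuclideanSpace ℝ (Fin m ⊕ Fin m) → ℝ, Continuous g →
    ∫ z, g z ∂ν = (m * 2 : ℝ)⁻¹ * ∑ k : Fin m × ℤˣ,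
      g ((√m * ((k.2 : ℤ) : ℝ)) • embed m α β (EuclideanSpace.single k.1 (1 : ℝ)))

/-- One replacement step of the Lindeberg scheme. -/
lemma abs_integral_step_le (hm : 0 < m) {α β p q t s : ℝ} (hs : 0 < s)
    (hr : 0 < α ^ 2 + β ^ 2) (hrs : m * ((α ^ 2 + β ^ 2) / s) ≤ 1 / 2)
    (hA : NonnegForm (p - s / (α ^ 2 + β ^ 2) * α ^ 2) (q - s / (α ^ 2 + β ^ 2) * (α * β))
      (t - s / (α ^ 2 + β ^ 2) * β ^ 2))
    (κ ν : Measure (EuclideanSpace ℝ (Fin m ⊕ Fin m))) [IsProbabilityMeasure κ]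
    [IsProbabilityMeasure ν] (hν : IsSketchStep ν α β)
    {f : EuclideanSpace ℝ (Fin m ⊕ Fin m) → ℝ} (hf : ContDiff ℝ 1 f) {K : NNReal}
    (hK : LipschitzWith K f) {M : ℝ} (hM : ∀ x, |f x| ≤ M) :
    |∫ x, f x ∂(κ ∗ (blockGaussian m p q t ∗ ν))
        - ∫ x, f x ∂(κ ∗ (blockGaussian m p q t ∗ blockGaussian m (α ^ 2) (α * β) (β ^ 2)))|
      ≤ 2 * K * √s * √(m ^ 3) * ((α ^ 2 + β ^ 2) / s) ^ 2 := by
  set r := α ^ 2 + β ^ 2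
  -- The normalization makes `embed m (c * α) (c * β)` equal to `√s` times an isometry.
  set c := √(s / r) with hc
  have hc2 : c ^ 2 = s / r := Real.sq_sqrt (by positivity)
  set e := embed m (c * α) (c * β)
  -- Hypothesis `hA` lets a component of variance `s` in the direction `(α, β)` be split off. The
  -- rest joins `κ`, and the comparison takes place in dimension `m`, on the image of `e`.
  have hG : blockGaussian m p q t = blockGaussian m (p - s / r * α ^ 2) (q - s / r * (α * β))
      (t - s / r * β ^ 2) ∗ (stdGaussian (EuclideanSpace ℝ (Fin m))).map e := by
    rw [map_embed_stdGaussian, blockGaussian_conv hA (nonnegForm_sq _ _)]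
    congr 1 <;> rw [← hc2] <;> ring
  have hpe : IsProbabilityMeasure ((stdGaussian (EuclideanSpace ℝ (Fin m))).map e) :=
    Measure.isProbabilityMeasure_map (by fun_prop)
  have hassoc : ∀ (η : Measure (EuclideanSpace ℝ (Fin m ⊕ Fin m))) [IsProbabilityMeasure η],
      κ ∗ (blockGaussian m p q t ∗ η) = (κ ∗ blockGaussian m (p - s / r * α ^ 2)
        (q - s / r * (α * β)) (t - s / r * β ^ 2)) ∗
          ((stdGaussian (EuclideanSpace ℝ (Fin m))).map e ∗ η) := fun η _ => by
    rw [hG, Measure.conv_assoc, Measure.conv_assoc]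
  rw [hassoc, hassoc]
  refine abs_integral_conv_sub_le (κ ∗ blockGaussian m (p - s / r * α ^ 2) (q - s / r * (α * β))
      (t - s / r * β ^ 2)) ((stdGaussian (EuclideanSpace ℝ (Fin m))).map e ∗ ν)
    ((stdGaussian (EuclideanSpace ℝ (Fin m))).map e ∗ blockGaussian m (α ^ 2) (α * β) (β ^ 2))
    hf.continuous hM fun y => ?_
  have hfy : ContDiff ℝ 1 fun z => f (y + z) := hf.comp (by fun_prop)
  have hMy : ∀ z, |f (y + z)| ≤ M := fun z => hM _
  let g : EuclideanSpace ℝ (Fin m) → ℝ := fun x => f (y + e x)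
  have hg : ContDiff ℝ 1 g := hf.comp (by fun_prop)
  have hen : ∀ x, ‖e x‖ = √s * ‖x‖ := by
    intro x
    rw [← Real.sqrt_sq (norm_nonneg (e x)), norm_sq_embed, mul_pow, mul_pow, ← mul_add, hc2,
      div_mul_cancel₀ _ hr.ne', Real.sqrt_mul hs.le, Real.sqrt_sq (norm_nonneg x)]
  have hgK : LipschitzWith (K * (√s).toNNReal) g := by
    refine hK.comp ?_
    refine LipschitzWith.of_dist_le_mul fun x x' => ?_
    rw [dist_add_left, dist_eq_norm, ← map_sub, hen, dist_eq_norm, Real.coe_toNNReal _ (by positivity)]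
  have h := abs_signed_basis_sub_gaussian_le hm (a := r / s) (by positivity) hrs hg hgK
    (fun x => hM _)
  -- A shift of length `√(m a)` with `a = r / s` is mapped by `e` exactly onto a sketch step.
  have hrsc : √(m * (r / s)) * c = √m := by
    rw [hc, ← Real.sqrt_mul (by positivity)]
    congr 1; field_simp
  have h1 : ∫ z, f (y + z) ∂((stdGaussian (EuclideanSpace ℝ (Fin m))).map e ∗ ν)
      = (m * 2 : ℝ)⁻¹ * ∑ k : Fin m × ℤˣ,
          ∫ x, g (x + (√(m * (r / s)) * ((k.2 : ℤ) : ℝ)) • EuclideanSpace.single k.1 (1 : ℝ))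
            ∂(stdGaussian (EuclideanSpace ℝ (Fin m))) := by
    rw [integral_conv_of_bounded _ _ hfy.continuous hMy, integral_map (by fun_prop)]
    · rw [← integral_finsetSum, ← integral_const_mul]
      · refine integral_congr_ae (ae_of_all _ fun x => ?_)
        simp only
        rw [hν _ (by have := hf.continuous; fun_prop)]
        congr 1
        refine Finset.sum_congr rfl fun k _ => ?_
        simp only [g, e, map_add, map_smul]
        congr 3
        rw [smul_embed, smul_embed, ← hrsc]
        congr 1
        congr 1 <;> ring
      · intro k _
        refine integrable_of_continuous_of_bounded _ ?_ fun x => hM _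
        have := hg.continuous
        fun_prop
    · refine (StronglyMeasurable.integral_prod_left (f := fun z x => f (y + (x + z))) ?_).aestronglyMeasurable
      refine Continuous.stronglyMeasurable ?_
      have := hf.continuous
      fun_prop
  have h2 : ∫ z, f (y + z) ∂((stdGaussian (EuclideanSpace ℝ (Fin m))).map e ∗
        blockGaussian m (α ^ 2) (α * β) (β ^ 2))
      = ∫ x, g (√(1 + r / s) • x) ∂(stdGaussian (EuclideanSpace ℝ (Fin m))) := by
    have hd : (√(1 + r / s) * c) ^ 2 = s / r + 1 := by
      rw [mul_pow, hc2, Real.sq_sqrt (by positivity)]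
      field_simp
    have : (stdGaussian (EuclideanSpace ℝ (Fin m))).map e ∗
        blockGaussian m (α ^ 2) (α * β) (β ^ 2) = (stdGaussian (EuclideanSpace ℝ (Fin m))).map
          (embed m (√(1 + r / s) * c * α) (√(1 + r / s) * c * β)) := by
      rw [map_embed_stdGaussian, map_embed_stdGaussian,
        blockGaussian_conv (nonnegForm_sq _ _) (nonnegForm_sq _ _)]
      congr 1
      · rw [mul_pow, mul_pow, hd, hc2]; ring
      · rw [mul_mul_mul_comm, mul_mul_mul_comm (√(1 + r / s) * c), ← pow_two, ← pow_two, hd, hc2]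
        ring
      · rw [mul_pow, mul_pow, hd, hc2]; ring
    rw [this, integral_map (by fun_prop) (by have := hf.continuous; fun_prop)]
    refine integral_congr_ae (ae_of_all _ fun x => ?_)
    simp only [g, e, map_smul, smul_embed, mul_assoc]
  rw [h1, h2]
  refine h.trans (le_of_eq ?_)
  push_cast
  rw [Real.coe_toNNReal _ (by positivity)]
  ring

end BlockGaussian

/-! ### Balanced covariances and the potential -/

/-- The covariance is `(ε² + t/2) I` plus a traceless matrix of operator norm `√(u² + v²) ≤ √(ρt)/2
≤ (ρ + t)/4`. The rank-one matrix subtracted has norm `(ε² + t)/4`. Since `ρ ≤ ε²`, the two norms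
together stay below `ε² + t/2`. -/
lemma nonnegForm_sub_of_balanced {u v t ρ ε : ℝ} (ht : 0 ≤ t) (hρ : 0 ≤ ρ) (hρε : ρ ≤ ε ^ 2)
    (huv : u ^ 2 + v ^ 2 ≤ ρ * t / 4) {α β : ℝ} (hr : 0 < α ^ 2 + β ^ 2) :
    NonnegForm (ε ^ 2 + (t / 2 + u) - (ε ^ 2 + t) / 4 / (α ^ 2 + β ^ 2) * α ^ 2)
      (v - (ε ^ 2 + t) / 4 / (α ^ 2 + β ^ 2) * (α * β))
      (ε ^ 2 + (t / 2 - u) - (ε ^ 2 + t) / 4 / (α ^ 2 + β ^ 2) * β ^ 2) := by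
  intro x y
  have hq : 0 ≤ x ^ 2 + y ^ 2 := by positivity
  have h1 : |u * (x ^ 2 - y ^ 2) + v * (2 * x * y)| ≤ (ρ + t) / 4 * (x ^ 2 + y ^ 2) := by
    refine abs_le_of_sq_le_sq ?_ (by positivity)
    have e1 : (u * (x ^ 2 - y ^ 2) + v * (2 * x * y)) ^ 2
        ≤ (u ^ 2 + v ^ 2) * (x ^ 2 + y ^ 2) ^ 2 := by
      nlinarith [sq_nonneg (u * (2 * x * y) - v * (x ^ 2 - y ^ 2))]
    have e2 : (u ^ 2 + v ^ 2) * (x ^ 2 + y ^ 2) ^ 2 ≤ (ρ * t / 4) * (x ^ 2 + y ^ 2) ^ 2 := by gcongr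
    have e3 : (ρ * t / 4) ≤ ((ρ + t) / 4) ^ 2 := by nlinarith [sq_nonneg (ρ - t)]
    calc _ ≤ _ := e1.trans e2
      _ ≤ ((ρ + t) / 4) ^ 2 * (x ^ 2 + y ^ 2) ^ 2 := by gcongr
      _ = _ := by ring
  have h2 : (ε ^ 2 + t) / 4 / (α ^ 2 + β ^ 2) * (α * x + β * y) ^ 2
      ≤ (ε ^ 2 + t) / 4 * (x ^ 2 + y ^ 2) := by
    rw [div_mul_eq_mul_div, div_le_iff₀ hr, mul_assoc]
    gcongr
    nlinarith [sq_nonneg (α * y - β * x)]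
  have h3 := (abs_le.1 h1).1
  have h4 : (ρ + t) / 4 * (x ^ 2 + y ^ 2) ≤ (ε ^ 2 + t) / 4 * (x ^ 2 + y ^ 2) := by gcongr
  have h5 : 0 ≤ (ε ^ 2 + t) * (x ^ 2 + y ^ 2) := by positivity
  have h6 : 0 ≤ ε ^ 2 * (x ^ 2 + y ^ 2) := by positivity
  nlinarith

/-- A discrete form of `a^{-3/2} da = -2 d(a^{-1/2})`; since `r ≤ a`, the endpoint `a + r` is
comparable to `a` and doubling the constant suffices. -/
lemma mul_rpow_le_potential {a r : ℝ} (ha : 0 < a) (hr : 0 ≤ r) (hra : r ≤ a) :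
    r / (a * √a) ≤ 4 * (1 / √a - 1 / √(a + r)) := by
  have h1 : 0 < √a := Real.sqrt_pos.2 ha
  have h2 : √a ^ 2 = a := Real.sq_sqrt ha.le
  have h3 : √(a + r) ^ 2 = a + r := Real.sq_sqrt (by positivity)
  set x := √a
  set y := √(a + r)
  have hxy : x ≤ y := Real.sqrt_le_sqrt (by linarith)
  have hy : 0 < y := by linarith
  have hr' : r = (y - x) * (y + x) := by nlinarith
  have hy2 : y ≤ 3 / 2 * x := by
    by_contra hc; push Not at hc
    nlinarith
  rw [hr', ← h2, div_sub_div _ _ h1.ne' hy.ne', ← mul_div_assoc, div_le_div_iff₀ (by positivity) (by positivity)]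
  have hd : 0 ≤ y - x := by linarith
  have : (y + x) * y ≤ 4 * x ^ 2 := by nlinarith
  calc (y - x) * (y + x) * (x * y) = ((y - x) * x) * ((y + x) * y) := by ring
    _ ≤ ((y - x) * x) * (4 * x ^ 2) := by gcongr
    _ = _ := by ring

/-- A replacement step, with the error bounded by the increment of a potential. -/
lemma abs_integral_step_le_potential {m : ℕ} (hm : 0 < m) {u v t ρ ε α β : ℝ} (hε : 0 < ε)
    (ht : 0 ≤ t) (hρ : α ^ 2 + β ^ 2 ≤ ρ) (hρε : 8 * m * ρ ≤ ε ^ 2)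
    (huv : u ^ 2 + v ^ 2 ≤ ρ * t / 4)
    (κ ν : Measure (EuclideanSpace ℝ (Fin m ⊕ Fin m))) [IsProbabilityMeasure κ]
    [IsProbabilityMeasure ν] (hν : IsSketchStep ν α β)
    {f : EuclideanSpace ℝ (Fin m ⊕ Fin m) → ℝ} (hf : ContDiff ℝ 1 f) {K : NNReal}
    (hK : LipschitzWith K f) {M : ℝ} (hM : ∀ x, |f x| ≤ M) :
    |∫ x, f x ∂(κ ∗ (blockGaussian m (ε ^ 2 + (t / 2 + u)) v (ε ^ 2 + (t / 2 - u)) ∗ ν))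
      - ∫ x, f x ∂(κ ∗ (blockGaussian m (ε ^ 2 + (t / 2 + u)) v (ε ^ 2 + (t / 2 - u)) ∗
          blockGaussian m (α ^ 2) (α * β) (β ^ 2)))|
      ≤ 64 * K * √(m ^ 3) * ρ * (1 / √(ε ^ 2 + t) - 1 / √(ε ^ 2 + t + (α ^ 2 + β ^ 2))) := by
  have hm1 : (1 : ℝ) ≤ m := by exact_mod_cast hm
  have ha : 0 < ε ^ 2 + t := by positivity
  have hr0 : 0 ≤ α ^ 2 + β ^ 2 := by positivity
  have hρ0 : 0 ≤ ρ := hr0.trans hρ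
  have hρε' : ρ ≤ ε ^ 2 := by nlinarith
  -- When `α = β = 0`, both the step and its Gaussian substitute are the point mass at `0`; this
  -- case is separate because the direction `(α, β)` is undefined.
  rcases hr0.eq_or_lt with h0 | hpos
  · have hα0 : α = 0 := by nlinarith [sq_nonneg α, sq_nonneg β]
    have hβ0 : β = 0 := by nlinarith [sq_nonneg α, sq_nonneg β]
    have he : embed m (0 : ℝ) 0 = 0 := by
      ext x i; rcases i with i | i <;> simp
    have : NeZero m := ⟨hm.ne'⟩
    rw [← h0]
    simp only [add_zero, sub_self, mul_zero]
    rw [← Measure.conv_assoc, ← Measure.conv_assoc]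
    refine abs_integral_conv_sub_le _ _ _ hf.continuous hM fun y => ?_
    rw [hν _ (by have := hf.continuous; fun_prop), ← map_embed_stdGaussian,
      integral_map (by fun_prop) (by have := hf.continuous; fun_prop), hα0, hβ0, he]
    simp only [zero_apply, smul_zero, add_zero, Finset.sum_const, Finset.card_univ, nsmul_eq_mul,
      integral_const, probReal_univ, one_smul, Fintype.card_prod, Fintype.card_fin,
      Fintype.card_units_int]
    rw [← mul_assoc, Nat.cast_mul, Nat.cast_ofNat, inv_mul_cancel₀ (by positivity), one_mul,
      sub_self, abs_zero]
  · have hs := abs_integral_step_le hm (s := (ε ^ 2 + t) / 4) (by positivity) hpos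
      (p := ε ^ 2 + (t / 2 + u)) (q := v) (t := ε ^ 2 + (t / 2 - u)) ?_
      (nonnegForm_sub_of_balanced ht hρ0 hρε' huv hpos) κ ν hν hf hK hM
    · refine hs.trans ?_
      have hp := mul_rpow_le_potential ha hr0 ((hρ.trans hρε').trans (le_add_of_nonneg_right ht))
      set a := ε ^ 2 + t
      set r := α ^ 2 + β ^ 2
      have h4 : √(a / 4) = √a / 2 := by
        rw [Real.sqrt_div' _ (by norm_num)]; congr 1
        rw [show (4 : ℝ) = 2 ^ 2 by norm_num]; exact Real.sqrt_sq (by norm_num)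
      have hsa : 0 < √a := Real.sqrt_pos.2 ha
      have hsa2 : √a * √a = a := Real.mul_self_sqrt ha.le
      calc 2 * (K : ℝ) * √(a / 4) * √(m ^ 3) * (r / (a / 4)) ^ 2
          = 16 * K * √(m ^ 3) * r * (r / (a * √a)) := by
            rw [h4]; field_simp; rw [pow_two (√a), hsa2]; ring
        _ ≤ 16 * K * √(m ^ 3) * ρ * (4 * (1 / √a - 1 / √(a + r))) := by gcongr
        _ = _ := by ring
    · rw [← mul_div_assoc, div_le_iff₀ (by positivity)]
      have : m * (α ^ 2 + β ^ 2) ≤ m * ρ := by gcongr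
      nlinarith

/-! ### Lindeberg replacement in a balanced order -/

section Lindeberg

variable {ι Ω : Type*} [Fintype ι] [DecidableEq ι] [MeasurableSpace Ω] {m : ℕ}

/-- Lindeberg replacement for count-sketches smoothed by a Gaussian of covariance `ε² I`; the
replacement order keeps the covariance of the Gaussian part close to a multiple of `I`. -/
lemma abs_integral_sketch_sub_gaussian_le (hm : 0 < m) (P : Measure Ω) [IsProbabilityMeasure P]
    (X : ι → Ω → EuclideanSpace ℝ (Fin m ⊕ Fin m)) (hX : ∀ i, Measurable (X i))
    (hind : iIndepFun X P) (α β : ι → ℝ) (hstep : ∀ i, IsSketchStep (P.map (X i)) (α i) (β i))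
    (hα : ∑ i, α i ^ 2 = 1) (hαβ : ∑ i, α i * β i = 0) (hβ : ∑ i, β i ^ 2 = 1)
    {ρ ε : ℝ} (hε : 0 < ε) (hρ : ∀ i, α i ^ 2 + β i ^ 2 ≤ ρ) (hρε : 8 * m * ρ ≤ ε ^ 2)
    {f : EuclideanSpace ℝ (Fin m ⊕ Fin m) → ℝ} (hf : ContDiff ℝ 1 f) {K : NNReal}
    (hK : LipschitzWith K f) {M : ℝ} (hM : ∀ x, |f x| ≤ M) :
    |∫ x, f x ∂(P.map (fun ω => ∑ i, X i ω) ∗ blockGaussian m (ε ^ 2) 0 (ε ^ 2))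
      - ∫ x, f x ∂(blockGaussian m (ε ^ 2 + 1) 0 (ε ^ 2 + 1))| ≤ 64 * K * √(m ^ 3) * ρ / ε := by
  have hm1 : (1 : ℝ) ≤ m := by exact_mod_cast hm
  have hne : Nonempty ι := by
    by_contra hc
    rw [not_nonempty_iff] at hc
    simp at hα
  have hρ0 : 0 ≤ ρ := le_trans (by positivity) (hρ (Classical.arbitrary ι))
  have hρε' : ρ ≤ ε ^ 2 := by nlinarith
  -- `R` is the set of indices already replaced: `G R` is the Gaussian part including the smoothing,
  -- `T R` the law of the summands still to be replaced. The pair `(u, v)` records the traceless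
  -- part of the replaced covariance.
  let G : Finset ι → Measure (EuclideanSpace ℝ (Fin m ⊕ Fin m)) := fun R =>
    blockGaussian m (ε ^ 2 + ∑ i ∈ R, α i ^ 2) (∑ i ∈ R, α i * β i) (ε ^ 2 + ∑ i ∈ R, β i ^ 2)
  let T : Finset ι → Measure (EuclideanSpace ℝ (Fin m ⊕ Fin m)) := fun R =>
    P.map (fun ω => ∑ i ∈ Rᶜ, X i ω)
  have hT : ∀ R, IsProbabilityMeasure (T R) := fun R =>
    Measure.isProbabilityMeasure_map (Finset.measurable_sum _ fun i _ => hX i).aemeasurable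
  have hν : ∀ i, IsProbabilityMeasure (P.map (X i)) := fun i =>
    Measure.isProbabilityMeasure_map (hX i).aemeasurable
  let t : Finset ι → ℝ := fun R => ∑ i ∈ R, (α i ^ 2 + β i ^ 2)
  let u : Finset ι → ℝ := fun R => ∑ i ∈ R, (α i ^ 2 - β i ^ 2) / 2
  let v : Finset ι → ℝ := fun R => ∑ i ∈ R, α i * β i
  have ht0 : ∀ R, 0 ≤ t R := fun R => Finset.sum_nonneg fun i _ => by positivity
  have hsumα : ∀ R, ∑ i ∈ R, α i ^ 2 = t R / 2 + u R := fun R => by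
    simp only [t, u, Finset.sum_div, ← Finset.sum_add_distrib]
    exact Finset.sum_congr rfl fun i _ => by ring
  have hsumβ : ∀ R, ∑ i ∈ R, β i ^ 2 = t R / 2 - u R := fun R => by
    simp only [t, u, Finset.sum_div, ← Finset.sum_sub_distrib]
    exact Finset.sum_congr rfl fun i _ => by ring
  have main : ∀ n ≤ Fintype.card ι, ∃ R : Finset ι, R.card = n ∧ u R ^ 2 + v R ^ 2 ≤ ρ * t R / 4 ∧
      |∫ x, f x ∂(T R ∗ G R) - ∫ x, f x ∂(T ∅ ∗ G ∅)|
        ≤ 64 * K * √(m ^ 3) * ρ * (1 / ε - 1 / √(ε ^ 2 + t R)) := by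
    intro n
    induction n with
    | zero => intro _; exact ⟨∅, by simp [u, v, t, Real.sqrt_sq hε.le]⟩
    | succ n ih =>
      intro hn
      obtain ⟨R, hRc, hbal, hR⟩ := ih (by omega)
      -- The total traceless part vanishes, so the remaining ones sum to `-(u R, v R)`. Their inner
      -- products with `(u R, v R)` sum to `-(u² + v²) ≤ 0`, hence cannot all be positive.
      obtain ⟨j, hjR, hj⟩ : ∃ j ∈ Rᶜ, u R * ((α j ^ 2 - β j ^ 2) / 2) + v R * (α j * β j) ≤ 0 := by
        by_contra hc
        push Not at hc
        have hne : Rᶜ.Nonempty := by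
          rw [← Finset.card_pos, Finset.card_compl]; omega
        have h1 := Finset.sum_pos hc hne
        rw [Finset.sum_add_distrib, ← Finset.mul_sum, ← Finset.mul_sum] at h1
        have h2 : u R + ∑ i ∈ Rᶜ, (α i ^ 2 - β i ^ 2) / 2 = 0 := by
          rw [Finset.sum_add_sum_compl, ← Finset.sum_div, Finset.sum_sub_distrib, hα, hβ]; simp
        have h3 : v R + ∑ i ∈ Rᶜ, α i * β i = 0 := by
          rw [Finset.sum_add_sum_compl, hαβ]
        rw [eq_neg_of_add_eq_zero_right h2, eq_neg_of_add_eq_zero_right h3] at h1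
        nlinarith [sq_nonneg (u R), sq_nonneg (v R)]
      have hjR' : j ∉ R := by simpa using hjR
      set r := α j ^ 2 + β j ^ 2 with hr_def
      have hr0 : 0 ≤ r := by positivity
      have htj : t (insert j R) = t R + r := by
        simp only [t]; rw [Finset.sum_insert hjR']; ring
      refine ⟨insert j R, by rw [Finset.card_insert_of_notMem hjR', hRc], ?_, ?_⟩
      · have hu : u (insert j R) = u R + (α j ^ 2 - β j ^ 2) / 2 := by
          simp only [u]; rw [Finset.sum_insert hjR']; ring
        have hv : v (insert j R) = v R + α j * β j := by
          simp only [v]; rw [Finset.sum_insert hjR']; ring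
        rw [hu, hv, htj]
        -- With a nonpositive cross term the squared norm grows by at most `r²/4 ≤ ρ r/4`, so the
        -- balance invariant survives.
        have : ((α j ^ 2 - β j ^ 2) / 2) ^ 2 + (α j * β j) ^ 2 = r ^ 2 / 4 := by
          simp only [hr_def]; ring
        have : r ^ 2 ≤ ρ * r := by rw [pow_two]; gcongr; exact hρ j
        nlinarith
      · set κ := T (insert j R)
        have hTR : T R = κ ∗ P.map (X j) := by
          have hc : Rᶜ = insert j (insert j R)ᶜ := by
            ext i; by_cases hij : i = j
            · simp [hij, hjR']
            · simp [hij]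
          have hnj : j ∉ (insert j R)ᶜ := by simp
          simp only [T, κ]
          have := (hind.indepFun_finsetSum_of_notMem hX hnj).map_add_eq_map_conv_map
            (by have := hX; fun_prop) (hX j)
          rw [hc]
          simp_rw [Finset.sum_insert hnj, add_comm (X j _)]
          convert this using 2
          · ext1 ω; rw [Pi.add_apply, Finset.sum_apply]
          · congr 1; ext1 ω; rw [Finset.sum_apply]
        have hGi : G (insert j R) = G R ∗ blockGaussian m (α j ^ 2) (α j * β j) (β j ^ 2) := by
          simp only [G]
          rw [blockGaussian_conv _ (nonnegForm_sq _ _)]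
          · congr 1 <;> rw [Finset.sum_insert hjR'] <;> ring
          · intro x y
            have : 0 ≤ ∑ i ∈ R, (α i * x + β i * y) ^ 2 := Finset.sum_nonneg fun i _ => sq_nonneg _
            have e : ∑ i ∈ R, (α i * x + β i * y) ^ 2 = (∑ i ∈ R, α i ^ 2) * x ^ 2
                + 2 * (∑ i ∈ R, α i * β i) * x * y + (∑ i ∈ R, β i ^ 2) * y ^ 2 := by
              simp only [Finset.sum_mul, Finset.mul_sum, ← Finset.sum_add_distrib]
              exact Finset.sum_congr rfl fun i _ => by ring
            nlinarith [sq_nonneg (ε * x), sq_nonneg (ε * y)]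
        have hstep1 := abs_integral_step_le_potential hm hε (ht0 R) (hρ j) hρε hbal κ
          (P.map (X j)) (hstep j) hf hK hM
        rw [← hsumα, ← hsumβ] at hstep1
        have hTG : T R ∗ G R = κ ∗ (G R ∗ P.map (X j)) := by
          rw [hTR, Measure.conv_assoc, Measure.conv_comm (P.map (X j))]
        rw [hGi, htj, ← add_assoc (ε ^ 2)]
        rw [hTG, abs_sub_comm] at hR
        rw [abs_sub_comm] at hstep1
        rw [abs_sub_comm] at hR
        refine (abs_sub_le _ (∫ x, f x ∂(κ ∗ (G R ∗ P.map (X j)))) _).trans ?_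
        refine (add_le_add hstep1 hR).trans (le_of_eq ?_)
        ring
  obtain ⟨R, hRc, -, hR⟩ := main _ le_rfl
  have hRu : R = Finset.univ := Finset.card_eq_iff_eq_univ R |>.1 hRc
  subst hRu
  have e1 : T ∅ ∗ G ∅ = P.map (fun ω => ∑ i, X i ω) ∗ blockGaussian m (ε ^ 2) 0 (ε ^ 2) := by
    simp [T, G]
  have e2 : T Finset.univ ∗ G Finset.univ = blockGaussian m (ε ^ 2 + 1) 0 (ε ^ 2 + 1) := by
    simp [T, G, hα, hβ, hαβ]
  rw [e1, e2, abs_sub_comm] at hR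
  refine hR.trans ?_
  rw [mul_sub, ← mul_div_assoc, mul_one]
  have : 0 ≤ 64 * K * √(m ^ 3) * ρ * (1 / √(ε ^ 2 + t Finset.univ)) := by positivity
  linarith

end Lindeberg

/-! ### From smooth test functions to the Lévy-Prokhorov distance -/

section Smoothing

variable {E : Type*} [NormedAddCommGroup E] [InnerProductSpace ℝ E] [FiniteDimensional ℝ E]
  [MeasurableSpace E] [BorelSpace E]

open scoped Convolution in
/-- A bounded Lipschitz function is uniformly close to a `C¹` function with the same Lipschitz
constant. -/
lemma exists_contDiff_lipschitz_approx {f : E → ℝ} {K : NNReal} (hK : LipschitzWith K f) {M : ℝ}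
    (hM : ∀ x, |f x| ≤ M) {τ : ℝ} (hτ : 0 < τ) :
    ∃ g : E → ℝ, ContDiff ℝ 1 g ∧ LipschitzWith K g ∧ ∀ x, |g x - f x| ≤ τ := by
  obtain ⟨e, he, heK⟩ : ∃ e : ℝ, 0 < e ∧ K * e ≤ τ := by
    refine ⟨τ / (K + 1), by positivity, ?_⟩
    rw [← mul_div_assoc, div_le_iff₀ (by positivity)]
    nlinarith
  let φ : ContDiffBump (0 : E) := ⟨e / 2, e, half_pos he, half_lt_self he⟩
  have hli : LocallyIntegrable f (volume : Measure E) := hK.continuous.locallyIntegrable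
  let g : E → ℝ := φ.normed volume ⋆[ContinuousLinearMap.lsmul ℝ ℝ, volume] f
  have hgx : ∀ x, g x = ∫ t, φ.normed volume t * f (x - t) := fun x => rfl
  have hint : ∀ x, Integrable (fun t => φ.normed volume t * f (x - t)) := fun x =>
    φ.integrable_normed.mul_bdd (c := M)
      (by have := hK.continuous; exact (by fun_prop : Continuous fun t => f (x - t)).aestronglyMeasurable)
      (ae_of_all _ fun t => hM _)
  refine ⟨g, ?_, ?_, fun x => ?_⟩
  · exact φ.hasCompactSupport_normed.contDiff_convolution_left _ φ.contDiff_normed hli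
  · refine LipschitzWith.of_dist_le_mul fun x y => ?_
    rw [Real.dist_eq, hgx, hgx, ← integral_sub (hint x) (hint y)]
    have h1 : ∀ t, ‖φ.normed volume t * f (x - t) - φ.normed volume t * f (y - t)‖
        ≤ φ.normed volume t * (K * dist x y) := by
      intro t
      rw [← mul_sub, norm_mul, Real.norm_of_nonneg (φ.nonneg_normed t)]
      gcongr
      · exact φ.nonneg_normed t
      · have := hK.dist_le_mul (x - t) (y - t)
        rwa [dist_sub_right, Real.dist_eq] at this
    refine (norm_integral_le_of_norm_le (φ.integrable_normed.mul_const _) (ae_of_all _ h1)).trans ?_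
    rw [integral_mul_const, φ.integral_normed, one_mul]
  · have := φ.dist_normed_convolution_le (μ := (volume : Measure E)) (x₀ := x) (ε := τ)
      hK.continuous.aestronglyMeasurable fun y hy => ?_
    · rwa [Real.dist_eq] at this
    · refine (hK.dist_le_mul y x).trans (le_trans ?_ heK)
      gcongr
      exact (Metric.mem_ball.1 hy).le

lemma integrable_norm_stdGaussian : Integrable (fun x : E => ‖x‖) (stdGaussian E) :=
  (IsGaussian.integrable_id (μ := stdGaussian E)).norm

lemma integral_norm_stdGaussian_le :
    ∫ x, ‖x‖ ∂(stdGaussian E) ≤ √(Module.finrank ℝ E) := by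
  have hsq : MemLp (fun x : E => x) 2 (stdGaussian E) := IsGaussian.memLp_two_id
  have hsi : Integrable (fun x : E => ‖x‖ ^ 2) (stdGaussian E) := hsq.norm.integrable_sq
  let b := stdOrthonormalBasis ℝ E
  have hint : ∫ x, ‖x‖ ^ 2 ∂(stdGaussian E) = Module.finrank ℝ E := by
    simp_rw [← b.sum_sq_inner_right]
    have hL : ∀ i, MemLp (fun x : E => (inner ℝ (b i) x : ℝ)) 2 (stdGaussian E) := fun i =>
      IsGaussian.memLp_dual _ (innerSL ℝ (b i)) 2 (by simp)
    rw [integral_finsetSum _ fun i _ => (hL i).integrable_sq]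
    have h1 : ∀ i, ∫ x, (inner ℝ (b i) x : ℝ) ^ 2 ∂(stdGaussian E) = 1 := by
      intro i
      have := lintegral_sq_dual_stdGaussian (innerSL ℝ (b i) : StrongDual ℝ E)
      simp only [innerSL_apply_apply, innerSL_apply_norm, b.norm_eq_one] at this
      rw [← ofReal_integral_eq_lintegral_ofReal (hL i).integrable_sq
        (ae_of_all _ fun _ => sq_nonneg _)] at this
      simpa using this
    simp [h1]
  rcases (Nat.cast_nonneg (α := ℝ) (Module.finrank ℝ E)).eq_or_lt with h0 | hpos
  · rw [← h0, Real.sqrt_zero]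
    have h2 : Subsingleton E := Module.finrank_zero_iff.1 (by exact_mod_cast h0.symm)
    simp [Subsingleton.elim _ (0 : E)]
  · set c := √(Module.finrank ℝ E : ℝ)
    have hc : 0 < c := Real.sqrt_pos.2 hpos
    have hc2 : c * c = Module.finrank ℝ E := Real.mul_self_sqrt hpos.le
    -- The arithmetic-geometric mean inequality, with `c` chosen so that the right side integrates
    -- to `c`.
    have h1 : ∫ x, ‖x‖ ∂(stdGaussian E) ≤ ∫ x : E, (c / 2 + (2 * c)⁻¹ * ‖x‖ ^ 2) ∂(stdGaussian E) := by
      refine integral_mono integrable_norm_stdGaussian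
        ((integrable_const _).add (hsi.const_mul _)) fun x => ?_
      have : c / 2 + (2 * c)⁻¹ * ‖x‖ ^ 2 - ‖x‖ = (2 * c)⁻¹ * (c - ‖x‖) ^ 2 := by field_simp; ring
      have : 0 ≤ (2 * c)⁻¹ * (c - ‖x‖) ^ 2 := by positivity
      simp only; linarith
    refine h1.trans (le_of_eq ?_)
    rw [integral_add (integrable_const _) (hsi.const_mul _), integral_const_mul, hint, ← hc2]
    simp; field_simp; norm_num

/-- Gaussian smoothing at scale `ε` changes the integral of a `K`-Lipschitz function by at most
`K ε √n`. -/
lemma abs_integral_sub_conv_gaussian_le (μ : Measure E) [IsProbabilityMeasure μ] {ε : ℝ}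
    (hε : 0 ≤ ε) {f : E → ℝ} {K : NNReal} (hK : LipschitzWith K f) {M : ℝ}
    (hM : ∀ x, |f x| ≤ M) :
    |∫ x, f x ∂μ - ∫ x, f x ∂(μ ∗ (stdGaussian E).map (fun x => ε • x))|
      ≤ K * ε * √(Module.finrank ℝ E) := by
  have hp : IsProbabilityMeasure ((stdGaussian E).map (fun x => ε • x)) :=
    Measure.isProbabilityMeasure_map (by fun_prop)
  -- Writing `μ` as a convolution reduces the claim to comparing the smoothing Gaussian with a point
  -- mass.
  have h0 : μ = μ ∗ Measure.dirac 0 := by rw [Measure.conv_dirac_zero]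
  conv_lhs => enter [1, 1]; rw [h0]
  refine abs_integral_conv_sub_le _ _ _ hK.continuous hM fun y => ?_
  have hc := hK.continuous
  rw [integral_dirac, add_zero, integral_map (by fun_prop) (by fun_prop)]
  have h1 : f y = ∫ _, f y ∂(stdGaussian E) := by simp
  have hi : Integrable (fun x => f (y + ε • x)) (stdGaussian E) :=
    integrable_of_continuous_of_bounded _ (by fun_prop) fun x => hM _
  rw [h1, ← integral_sub (integrable_const _) hi]
  have h2 : ∀ x, ‖f y - f (y + ε • x)‖ ≤ K * ε * ‖x‖ := by
    intro x
    have := hK.dist_le_mul y (y + ε • x)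
    rwa [Real.dist_eq, dist_self_add_right, norm_smul, Real.norm_of_nonneg hε, ← mul_assoc] at this
  refine (norm_integral_le_of_norm_le (integrable_norm_stdGaussian.const_mul _)
    (ae_of_all _ h2)).trans ?_
  rw [integral_const_mul]
  gcongr
  exact integral_norm_stdGaussian_le

/-- Bound on the Lévy-Prokhorov distance by smoothed test functions. -/
lemma levyProkhorovEDist_le_of_smooth_test (μ ν : Measure E) [IsProbabilityMeasure μ]
    [IsProbabilityMeasure ν] {η ε B : ℝ} (hη : 0 < η) (hε : 0 ≤ ε) (hB : 0 ≤ B)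
    (hεη : ε * √(Module.finrank ℝ E) ≤ η ^ 2)
    (h : ∀ f : E → ℝ, ContDiff ℝ 1 f → LipschitzWith (η⁻¹).toNNReal f → (∀ x, |f x| ≤ 1 + η) →
      |∫ x, f x ∂(μ ∗ (stdGaussian E).map (fun x => ε • x))
        - ∫ x, f x ∂(ν ∗ (stdGaussian E).map (fun x => ε • x))| ≤ B) :
    levyProkhorovEDist μ ν ≤ ENNReal.ofReal (4 * η + B) := by
  refine levyProkhorovEDist_le_of_forall_le μ ν _ fun c A hc hcT hA => ?_
  have hηc : η ≤ c.toReal := by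
    have := (ENNReal.ofReal_lt_iff_lt_toReal (by positivity) hcT.ne).1 hc
    linarith
  let f₀ : E → ℝ := fun x => (thickenedIndicator hη A x : ℝ)
  have hf₀ : LipschitzWith (η⁻¹).toNNReal f₀ := by
    have h1 := lipschitzWith_thickenedIndicator hη A
    refine LipschitzWith.of_dist_le_mul fun x y => ?_
    have := h1.dist_le_mul x y
    rwa [NNReal.dist_eq, ← Real.toNNReal_inv] at this
  have h01 : ∀ x, 0 ≤ f₀ x ∧ f₀ x ≤ 1 := fun x =>
    ⟨NNReal.coe_nonneg _, by exact_mod_cast thickenedIndicator_le_one hη A x⟩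
  have hf₀M : ∀ x, |f₀ x| ≤ 1 := fun x => abs_le.2 ⟨by linarith [(h01 x).1], (h01 x).2⟩
  obtain ⟨g, hg, hgK, hgf⟩ := exists_contDiff_lipschitz_approx hf₀ hf₀M hη
  have hgM : ∀ x, |g x| ≤ 1 + η := fun x => by
    have h1 := abs_le.1 (hgf x); have h2 := h01 x
    exact abs_le.2 ⟨by linarith, by linarith⟩
  have hKη : ((η⁻¹).toNNReal : ℝ) * ε * √(Module.finrank ℝ E) ≤ η := by
    rw [Real.coe_toNNReal _ (by positivity), mul_assoc, inv_mul_le_iff₀ hη, ← pow_two]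
    exact hεη
  have hsμ := (abs_integral_sub_conv_gaussian_le μ hε hgK hgM).trans hKη
  have hsν := (abs_integral_sub_conv_gaussian_le ν hε hgK hgM).trans hKη
  have hB' := h g hg hgK hgM
  have happ : ∀ (ξ : Measure E) [IsProbabilityMeasure ξ], |∫ x, g x ∂ξ - ∫ x, f₀ x ∂ξ| ≤ η := by
    intro ξ _
    rw [← integral_sub (integrable_of_continuous_of_bounded _ hg.continuous hgM)
      (integrable_of_continuous_of_bounded _ hf₀.continuous hf₀M)]
    have := norm_integral_le_of_norm_le_const (μ := ξ) (f := fun x => g x - f₀ x) (ae_of_all _ hgf)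
    simpa using this
  have hT : MeasurableSet (Metric.thickening η A) := Metric.isOpen_thickening.measurableSet
  have hlow : μ.real A ≤ ∫ x, f₀ x ∂μ := by
    rw [← integral_indicator_one hA]
    refine integral_mono ((integrable_const _).indicator hA)
      (integrable_of_continuous_of_bounded _ hf₀.continuous hf₀M) fun x => ?_
    by_cases hx : x ∈ A
    · simp only [Set.indicator_of_mem hx, Pi.one_apply, f₀, thickenedIndicator_one hη A hx,
        NNReal.coe_one, le_refl]
    · simpa [hx] using (h01 x).1
  have hup : ∫ x, f₀ x ∂ν ≤ ν.real (Metric.thickening η A) := by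
    rw [← integral_indicator_one hT]
    refine integral_mono (integrable_of_continuous_of_bounded _ hf₀.continuous hf₀M)
      ((integrable_const _).indicator hT) fun x => ?_
    by_cases hx : x ∈ Metric.thickening η A
    · simpa [hx] using (h01 x).2
    · simp only [Set.indicator_of_notMem hx, f₀, thickenedIndicator_zero hη A hx,
        NNReal.coe_zero, le_refl]
  -- Each of `μ` and `ν` costs `η` for the `C¹` approximation of the thickened indicator and `η` for
  -- the Gaussian smoothing; `B` compares the smoothed laws. For probability measures this one-sided
  -- inequality suffices.
  have key : μ.real A ≤ ν.real (Metric.thickening η A) + (4 * η + B) := by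
    have a1 := abs_le.1 hsμ; have a2 := abs_le.1 hsν; have a3 := abs_le.1 hB'
    have a4 := abs_le.1 (happ μ); have a5 := abs_le.1 (happ ν)
    linarith [a1.1, a1.2, a2.1, a2.2, a3.1, a3.2, a4.1, a4.2, a5.1, a5.2]
  calc μ A = ENNReal.ofReal (μ.real A) := (ofReal_measureReal).symm
    _ ≤ ENNReal.ofReal (ν.real (Metric.thickening η A) + (4 * η + B)) :=
        ENNReal.ofReal_le_ofReal key
    _ = ν (Metric.thickening η A) + ENNReal.ofReal (4 * η + B) := by
        rw [ENNReal.ofReal_add measureReal_nonneg (by positivity), ofReal_measureReal]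
    _ ≤ ν (Metric.thickening c.toReal A) + c := by
        gcongr

end Smoothing

/-! ### Quantitative central limit theorem -/

lemma map_smul_stdGaussian {m : ℕ} (ε : ℝ) :
    (stdGaussian (EuclideanSpace ℝ (Fin m ⊕ Fin m))).map (fun x => ε • x)
      = blockGaussian m (ε ^ 2) 0 (ε ^ 2) := by
  have hp : IsProbabilityMeasure
      ((stdGaussian (EuclideanSpace ℝ (Fin m ⊕ Fin m))).map (fun x => ε • x)) :=
    Measure.isProbabilityMeasure_map (by fun_prop)
  apply Measure.ext_of_charFun
  ext z
  rw [charFun_map_smul, charFun_stdGaussian, charFun_blockGaussian (fun x y => by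
    have : 0 ≤ (ε * x) ^ 2 + (ε * y) ^ 2 := by positivity
    nlinarith), norm_smul, ← Complex.ofReal_pow, mul_pow, EuclideanSpace.real_norm_sq_eq,
    Fintype.sum_sum_type, ← Finset.sum_add_distrib, Real.norm_eq_abs, sq_abs, Finset.mul_sum]
  congr 1
  push_cast
  congr 2
  refine Finset.sum_congr rfl fun l _ => ?_
  ring

/-- Quantitative central limit theorem for count-sketches: only `m² ρ` matters, where `ρ` bounds the
squared lengths of the whitened coordinates. -/
lemma levyProkhorovEDist_sketch_le {ι Ω : Type*} [Fintype ι] [DecidableEq ι] [MeasurableSpace Ω]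
    {m : ℕ} (hm : 0 < m) (P : Measure Ω) [IsProbabilityMeasure P]
    (X : ι → Ω → EuclideanSpace ℝ (Fin m ⊕ Fin m)) (hX : ∀ i, Measurable (X i))
    (hind : iIndepFun X P) (α β : ι → ℝ) (hstep : ∀ i, IsSketchStep (P.map (X i)) (α i) (β i))
    (hα : ∑ i, α i ^ 2 = 1) (hαβ : ∑ i, α i * β i = 0) (hβ : ∑ i, β i ^ 2 = 1)
    {ρ η : ℝ} (hη : 0 < η) (hρ : ∀ i, α i ^ 2 + β i ^ 2 ≤ ρ) (hρη : 16 * m ^ 2 * ρ ≤ η ^ 4) :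
    levyProkhorovEDist (P.map (fun ω => ∑ i, X i ω))
      (stdGaussian (EuclideanSpace ℝ (Fin m ⊕ Fin m))) ≤ ENNReal.ofReal (10 * η) := by
  have hm0 : (0 : ℝ) < m := by exact_mod_cast hm
  have hne : Nonempty ι := by
    by_contra hc
    rw [not_nonempty_iff] at hc
    simp at hα
  have hρ0 : 0 ≤ ρ := le_trans (by positivity) (hρ (Classical.arbitrary ι))
  have hprob : IsProbabilityMeasure (P.map (fun ω => ∑ i, X i ω)) :=
    Measure.isProbabilityMeasure_map (by fun_prop)
  -- The largest scale at which smoothing costs a `1/η`-Lipschitz function at most `η` in dimension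
  -- `2m`. The requirement `8 m ρ ≤ ε²` then becomes precisely `16 m² ρ ≤ η⁴`.
  set ε := η ^ 2 / √(2 * m) with hεdef
  have hs : 0 < √(2 * m : ℝ) := by positivity
  have hε : 0 < ε := by positivity
  have hε2 : ε ^ 2 = η ^ 4 / (2 * m) := by
    rw [hεdef, div_pow, Real.sq_sqrt (by positivity)]; ring
  have hfin : √(Module.finrank ℝ (EuclideanSpace ℝ (Fin m ⊕ Fin m)) : ℝ) = √(2 * m) := by
    congr 1
    rw [finrank_euclideanSpace]; simp; ring
  have h := levyProkhorovEDist_le_of_smooth_test (P.map (fun ω => ∑ i, X i ω))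
    (stdGaussian (EuclideanSpace ℝ (Fin m ⊕ Fin m))) (η := η) (ε := ε) (B := 6 * η) hη hε.le
    (by positivity) (by rw [hfin, div_mul_cancel₀ _ hs.ne']) ?_
  · convert h using 2; ring
  intro f hf hK hM
  have hL := abs_integral_sketch_sub_gaussian_le hm P X hX hind α β hstep hα hαβ hβ hε hρ
    (by rw [hε2, le_div_iff₀ (by positivity)]; linarith) hf hK hM
  have hc : stdGaussian (EuclideanSpace ℝ (Fin m ⊕ Fin m)) ∗ blockGaussian m (ε ^ 2) 0 (ε ^ 2)
      = blockGaussian m (ε ^ 2 + 1) 0 (ε ^ 2 + 1) := by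
    rw [← blockGaussian_one, blockGaussian_conv]
    · congr 1 <;> ring
    · intro x y
      nlinarith [sq_nonneg x, sq_nonneg y]
    · intro x y
      nlinarith [sq_nonneg (ε * x), sq_nonneg (ε * y)]
  rw [map_smul_stdGaussian, hc]
  refine hL.trans ?_
  rw [Real.coe_toNNReal _ (by positivity), hεdef]
  have h2 : √(m ^ 3 : ℝ) * √(2 * m) ≤ 3 / 2 * m ^ 2 := by
    rw [← Real.sqrt_mul (by positivity), Real.sqrt_le_left (by positivity)]
    nlinarith [pow_pos hm0 4]
  calc 64 * η⁻¹ * √(m ^ 3 : ℝ) * ρ / (η ^ 2 / √(2 * m))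
      = 64 * (√(m ^ 3 : ℝ) * √(2 * m)) * ρ / η ^ 3 := by field_simp
    _ ≤ 64 * (3 / 2 * m ^ 2) * ρ / η ^ 3 := by gcongr
    _ = 6 * (16 * m ^ 2 * ρ) / η ^ 3 := by ring
    _ ≤ 6 * η ^ 4 / η ^ 3 := by gcongr
    _ = 6 * η := by field_simp

instance : MeasurableSingletonClass ℤˣ where
  measurableSet_singleton e := by
    have h : MeasurableSet ((fun x : ℤˣ => (x : ℤ)) ⁻¹' {(e : ℤ)}) :=
      (comap_measurable _) (measurableSet_singleton _)
    convert h using 1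
    ext x; simp [Units.ext_iff]

/-! ### Explicit whitening of the sketch -/

section Whitening

variable {m : ℕ}

lemma blockCov_mul (p q t p' q' t' : ℝ) :
    blockCov m p q t * blockCov m p' q' t' = Matrix.fromBlocks
      ((p * p' + q * q') • (1 : Matrix (Fin m) (Fin m) ℝ))
      ((p * q' + q * t') • (1 : Matrix (Fin m) (Fin m) ℝ))
      ((q * p' + t * q') • (1 : Matrix (Fin m) (Fin m) ℝ))
      ((q * q' + t * t') • (1 : Matrix (Fin m) (Fin m) ℝ)) := by
  simp only [blockCov, Matrix.fromBlocks_multiply, Matrix.smul_mul, Matrix.one_mul,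
    smul_smul, add_smul]

lemma covMatrix_eq_blockCov {d : ℕ} (u v : EuclideanSpace ℝ (Fin d)) :
    covMatrix m u v = blockCov m (‖u‖ ^ 2 / m) (inner ℝ u v / m) (‖v‖ ^ 2 / m) := by
  rw [covMatrix, blockCov, Matrix.fromBlocks_smul, smul_smul, smul_smul, smul_smul]
  congr 2 <;> ring

/-- The quadratic form of a positive definite `2 × 2` matrix is nonnegative. -/
lemma nonnegForm_of_det_pos {A B C : ℝ} (hA : 0 ≤ A) (hdet : 0 < A * C - B ^ 2) :
    NonnegForm A B C := by
  intro x y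
  have hA' : 0 < A := by
    rcases hA.eq_or_lt with h | h
    · rw [← h] at hdet; nlinarith [sq_nonneg B]
    · exact h
  have h2 : A * (A * x ^ 2 + 2 * B * x * y + C * y ^ 2)
      = (A * x + B * y) ^ 2 + (A * C - B ^ 2) * y ^ 2 := by ring
  have : 0 ≤ A * (A * x ^ 2 + 2 * B * x * y + C * y ^ 2) := by rw [h2]; positivity
  exact nonneg_of_mul_nonneg_right this hA'

lemma form_pos_of_det_pos {A B C : ℝ} (hA : 0 ≤ A) (hdet : 0 < A * C - B ^ 2)
    {x y : ℝ} (hxy : x ≠ 0 ∨ y ≠ 0) : 0 < A * x ^ 2 + 2 * B * x * y + C * y ^ 2 := by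
  have hA' : 0 < A := by
    rcases hA.eq_or_lt with h | h
    · rw [← h] at hdet; nlinarith [sq_nonneg B]
    · exact h
  have h2 : A * (A * x ^ 2 + 2 * B * x * y + C * y ^ 2)
      = (A * x + B * y) ^ 2 + (A * C - B ^ 2) * y ^ 2 := by ring
  have : 0 < A * (A * x ^ 2 + 2 * B * x * y + C * y ^ 2) := by
    rw [h2]
    by_cases hy : y = 0
    · have hx : x ≠ 0 := by tauto
      subst hy; simp; positivity
    · positivity
  exact pos_of_mul_pos_right this hA'.le

lemma posDef_blockCov {A B C : ℝ} (hA : 0 ≤ A) (hdet : 0 < A * C - B ^ 2) :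
    (blockCov m A B C).PosDef := by
  refine Matrix.PosDef.of_dotProduct_mulVec_pos (isHermitian_blockCov A B C) fun x hx => ?_
  rw [star_trivial, dotProduct_blockCov]
  refine Finset.sum_pos' (fun l _ => nonnegForm_of_det_pos hA hdet _ _) ?_
  obtain ⟨i, hi⟩ := Function.ne_iff.1 hx
  rcases i with i | i
  · exact ⟨i, Finset.mem_univ _, form_pos_of_det_pos hA hdet (Or.inl hi)⟩
  · exact ⟨i, Finset.mem_univ _, form_pos_of_det_pos hA hdet (Or.inr hi)⟩

open scoped MatrixOrder in
/-- Explicit inverse square root of a block matrix. -/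
lemma inv_sqrt_blockCov (hm : 0 < m) {A B C D τ : ℝ} (hA : 0 ≤ A) (hC : 0 ≤ C) (hD : 0 < D)
    (hτ : 0 < τ) (hD2 : D ^ 2 = A * C - B ^ 2) (hτ2 : τ ^ 2 = A + C + 2 * D) :
    (CFC.sqrt (blockCov m (A / m) (B / m) (C / m)))⁻¹
      = blockCov m (√m * ((C + D) / (τ * D))) (√m * (-B / (τ * D))) (√m * ((A + D) / (τ * D))) := by
  have hm0 : (0 : ℝ) < m := by exact_mod_cast hm
  have hs : 0 < √(m : ℝ) := Real.sqrt_pos.2 hm0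
  have hs2 : √(m : ℝ) ^ 2 = m := Real.sq_sqrt hm0.le
  have hpos : NonnegForm ((A + D) / (τ * √m)) (B / (τ * √m)) ((C + D) / (τ * √m)) := by
    have h0 := nonnegForm_of_det_pos (A := A + D) (B := B) (C := C + D) (by positivity)
      (by nlinarith [sq_nonneg D, mul_nonneg hA hD.le, mul_nonneg hC hD.le])
    intro x y
    have : (A + D) / (τ * √m) * x ^ 2 + 2 * (B / (τ * √m)) * x * y + (C + D) / (τ * √m) * y ^ 2
        = ((A + D) * x ^ 2 + 2 * B * x * y + (C + D) * y ^ 2) / (τ * √m) := by ring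
    rw [this]
    exact div_nonneg (h0 x y) (by positivity)
  -- By Cayley-Hamilton, a positive definite `2 × 2` matrix `M` with `D = √(det M)` and `τ = √(tr M
  -- + 2D)` has square root `(M + D I)/τ`.
  have hsqrt : CFC.sqrt (blockCov m (A / m) (B / m) (C / m))
      = blockCov m ((A + D) / (τ * √m)) (B / (τ * √m)) ((C + D) / (τ * √m)) := by
    refine CFC.sqrt_unique ?_ hpos.posSemidef.nonneg
    rw [blockCov_mul, blockCov]
    have e : ∀ N : ℝ, N / (τ * √(m : ℝ) * (τ * √(m : ℝ))) = N / τ ^ 2 / m := fun N => by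
      rw [mul_mul_mul_comm, ← pow_two, ← pow_two, hs2, div_div]
    congr 2
    · rw [div_mul_div_comm, div_mul_div_comm, ← add_div, e]
      congr 1
      rw [div_eq_iff (by positivity), hτ2]; linear_combination hD2
    · rw [div_mul_div_comm, div_mul_div_comm, ← add_div, e]
      congr 1
      rw [div_eq_iff (by positivity), hτ2]; ring
    · rw [div_mul_div_comm, div_mul_div_comm, ← add_div, e]
      congr 1
      rw [div_eq_iff (by positivity), hτ2]; ring
    · rw [div_mul_div_comm, div_mul_div_comm, ← add_div, e]
      congr 1
      rw [div_eq_iff (by positivity), hτ2]; linear_combination hD2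
  rw [hsqrt]
  refine Matrix.inv_eq_right_inv ?_
  rw [blockCov_mul, ← Matrix.fromBlocks_one]
  have h1 : (A + D) * (C + D) - B ^ 2 = τ ^ 2 * D := by
    rw [hτ2]; linear_combination -hD2
  congr 1
  · convert one_smul ℝ (1 : Matrix (Fin m) (Fin m) ℝ)
    field_simp
    linear_combination h1
  · convert zero_smul ℝ (1 : Matrix (Fin m) (Fin m) ℝ)
    field_simp
    ring
  · convert zero_smul ℝ (1 : Matrix (Fin m) (Fin m) ℝ)
    field_simp
    ring
  · convert one_smul ℝ (1 : Matrix (Fin m) (Fin m) ℝ)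
    field_simp
    linear_combination h1

lemma whiten_blockCov_sketchPair {d : ℕ} (h : Fin d → Fin m) (s : Fin d → ℤˣ)
    (u v : EuclideanSpace ℝ (Fin d)) (p q t : ℝ) :
    Matrix.toEuclideanCLM (𝕜 := ℝ) (blockCov m (√m * p) (√m * q) (√m * t)) (sketchPair h s u v)
      = ∑ j, (√m * ((s j : ℤ) : ℝ)) •
          embed m (p * u j + q * v j) (q * u j + t * v j) (EuclideanSpace.single (h j) (1 : ℝ)) := by
  ext i
  rw [Matrix.ofLp_toEuclideanCLM, blockCov_mulVec, WithLp.ofLp_sum, Finset.sum_apply]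
  rcases i with l | l
  all_goals
    simp only [Sum.elim_inl, Sum.elim_inr, sketchPair, sketch, PiLp.smul_apply, embed_inl,
      embed_inr, smul_eq_mul, Finset.mul_sum, ← Finset.sum_add_distrib, Finset.sum_filter,
      PiLp.single_apply]
    refine Finset.sum_congr rfl fun j _ => ?_
    by_cases hj : h j = l
    · simp only [hj, if_true]; ring
    · simp [hj, Ne.symm hj]

end Whitening

/-! ### The whitened sketch as a sum of independent steps -/

section HashPair

variable {Ω : Type*} [MeasurableSpace Ω] {P : Measure Ω} [IsProbabilityMeasure P] {d m : ℕ}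
  {h : Fin d → Ω → Fin m} {s : Fin d → Ω → ℤˣ}

/-- The contribution of the coordinate `j` to the whitened sketch. -/
noncomputable def sketchTerm (h : Fin d → Ω → Fin m) (s : Fin d → Ω → ℤˣ) (α β : Fin d → ℝ)
    (j : Fin d) (ω : Ω) : EuclideanSpace ℝ (Fin m ⊕ Fin m) :=
  (√m * ((s j ω : ℤ) : ℝ)) • embed m (α j) (β j) (EuclideanSpace.single (h j ω) (1 : ℝ))

omit [IsProbabilityMeasure P] in
lemma IsHashPair.measurable_pair (hh : IsHashPair P h s) (j : Fin d) :
    Measurable fun ω => (h j ω, s j ω) :=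
  (hh.measurable_bucket j).prodMk (hh.measurable_sign j)

omit [IsProbabilityMeasure P] in
lemma IsHashPair.measurable_sketchTerm (hh : IsHashPair P h s) (α β : Fin d → ℝ) (j : Fin d) :
    Measurable (sketchTerm h s α β j) :=
  (measurable_of_finite fun k : Fin m × ℤˣ => (√m * ((k.2 : ℤ) : ℝ)) •
    embed m (α j) (β j) (EuclideanSpace.single k.1 (1 : ℝ))).comp (hh.measurable_pair j)

omit [IsProbabilityMeasure P] in
lemma IsHashPair.iIndepFun_sketchTerm (hh : IsHashPair P h s) (α β : Fin d → ℝ) :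
    iIndepFun (sketchTerm h s α β) P :=
  hh.indep_coord.comp (fun j (k : Fin m × ℤˣ) => (√m * ((k.2 : ℤ) : ℝ)) •
    embed m (α j) (β j) (EuclideanSpace.single k.1 (1 : ℝ))) fun _ => measurable_of_finite _

lemma IsHashPair.isSketchStep (hh : IsHashPair P h s) (α β : Fin d → ℝ) (j : Fin d) :
    IsSketchStep (P.map (sketchTerm h s α β j)) (α j) (β j) := by
  intro g hg
  rw [integral_map (hh.measurable_sketchTerm α β j).aemeasurable hg.aestronglyMeasurable]
  have hp := hh.measurable_pair j
  have : IsProbabilityMeasure (P.map fun ω => (h j ω, s j ω)) :=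
    Measure.isProbabilityMeasure_map hp.aemeasurable
  have h1 := integral_map (μ := P) hp.aemeasurable (f := fun k : Fin m × ℤˣ =>
    g ((√m * ((k.2 : ℤ) : ℝ)) • embed m (α j) (β j) (EuclideanSpace.single k.1 (1 : ℝ))))
    (measurable_of_finite _).aestronglyMeasurable
  simp only [sketchTerm]
  rw [← h1, integral_fintype Integrable.of_finite, Finset.mul_sum]
  refine Finset.sum_congr rfl fun k _ => ?_
  have h2 : (P.map fun ω => (h j ω, s j ω)).real {k} = (m * 2 : ℝ)⁻¹ := by
    rw [map_measureReal_apply hp (measurableSet_singleton k)]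
    have e : (fun ω => (h j ω, s j ω)) ⁻¹' {k} = h j ⁻¹' {k.1} ∩ s j ⁻¹' {k.2} := by
      ext ω; simp [Prod.ext_iff]
    have e1 := hh.bucket_uniform j k.1
    have e2 := hh.sign_uniform j k.2
    rw [e, measureReal_def, (hh.indep_bucket_sign j).measure_inter_preimage_eq_mul _ _
      (measurableSet_singleton _) (measurableSet_singleton _), ENNReal.toReal_mul]
    change P.real {ω | h j ω = k.1} * P.real {ω | s j ω = k.2} = _
    rw [e1, e2, mul_inv]; ring
  rw [h2, smul_eq_mul]

omit [IsProbabilityMeasure P] in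
lemma IsHashPair.measurable_sketchPair (hh : IsHashPair P h s) (u v : EuclideanSpace ℝ (Fin d)) :
    Measurable fun ω => sketchPair (fun j => h j ω) (fun j => s j ω) u v := by
  have hterm : ∀ (p : EuclideanSpace ℝ (Fin d)) (j : Fin d) (l : Fin m),
      Measurable fun ω => if h j ω = l then ((s j ω : ℤ) : ℝ) * p j else 0 := fun p j l =>
    (measurable_of_finite fun k : Fin m × ℤˣ =>
      if k.1 = l then ((k.2 : ℤ) : ℝ) * p j else 0).comp (hh.measurable_pair j)
  refine (WithLp.measurable_toLp 2 _).comp (measurable_pi_lambda _ fun i => ?_)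
  rcases i with l | l
  all_goals
    simp only [Sum.elim_inl, Sum.elim_inr, sketch, Finset.sum_filter]
    exact Finset.measurable_sum _ fun j _ => hterm _ j l

omit [IsProbabilityMeasure P] in
lemma IsHashPair.map_whiten (hh : IsHashPair P h s) (hm : 0 < m)
    (u v : EuclideanSpace ℝ (Fin d)) {A B C D τ : ℝ} (hA : 0 ≤ A) (hC : 0 ≤ C) (hD : 0 < D)
    (hτ : 0 < τ) (hD2 : D ^ 2 = A * C - B ^ 2) (hτ2 : τ ^ 2 = A + C + 2 * D) :
    (P.map fun ω => sketchPair (fun j => h j ω) (fun j => s j ω) u v).map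
        (whiten (blockCov m (A / m) (B / m) (C / m)))
      = P.map fun ω => ∑ j, sketchTerm h s
          (fun j => (C + D) / (τ * D) * u j + -B / (τ * D) * v j)
          (fun j => -B / (τ * D) * u j + (A + D) / (τ * D) * v j) j ω := by
  have hmeas := hh.measurable_sketchPair u v
  have hw : ∀ V : Matrix (Fin m ⊕ Fin m) (Fin m ⊕ Fin m) ℝ, Measurable (whiten V) := fun V => by
    unfold whiten; fun_prop
  rw [Measure.map_map (hw _) hmeas]
  congr 1
  ext1 ω
  rw [Function.comp_apply, whiten, inv_sqrt_blockCov hm hA hC hD hτ hD2 hτ2,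
    whiten_blockCov_sketchPair]
  simp only [sketchTerm]

/-- The rows of an inverse square root of a `2 × 2` Gram matrix orthonormalize the vectors. -/
lemma sum_orthonormalized {ι : Type*} [Fintype ι] (u v : ι → ℝ) {A B C D τ : ℝ} (hD : 0 < D)
    (hτ : 0 < τ) (hD2 : D ^ 2 = A * C - B ^ 2) (hτ2 : τ ^ 2 = A + C + 2 * D)
    (hA : A = ∑ j, u j ^ 2) (hB : B = ∑ j, u j * v j) (hC : C = ∑ j, v j ^ 2) :
    ∑ j, ((C + D) / (τ * D) * u j + -B / (τ * D) * v j) ^ 2 = 1 ∧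
    ∑ j, ((C + D) / (τ * D) * u j + -B / (τ * D) * v j) *
      (-B / (τ * D) * u j + (A + D) / (τ * D) * v j) = 0 ∧
    ∑ j, (-B / (τ * D) * u j + (A + D) / (τ * D) * v j) ^ 2 = 1 := by
  have hsum : ∀ a b a' b' : ℝ, ∑ j, (a * u j + b * v j) * (a' * u j + b' * v j)
      = a * a' * A + (a * b' + b * a') * B + b * b' * C := by
    intro a b a' b'
    rw [hA, hB, hC]
    simp only [Finset.mul_sum, ← Finset.sum_add_distrib]
    exact Finset.sum_congr rfl fun j _ => by ring
  simp only [pow_two (_ + _), hsum]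
  clear hsum hA hB hC
  refine ⟨?_, ?_, ?_⟩
  · field_simp
    rw [hτ2]
    linear_combination (-(C + 2 * D)) * hD2
  · field_simp
    linear_combination B * hD2
  · field_simp
    rw [hτ2]
    linear_combination (-(A + 2 * D)) * hD2

/-- Whitened squared length is the quadratic form of the inverse Gram matrix, whose determinant is
`D²`; the square root disappears. -/
lemma sq_add_sq_orthonormalized (x y : ℝ) {A B C D τ : ℝ} (hD : 0 < D)
    (hτ : 0 < τ) (hD2 : D ^ 2 = A * C - B ^ 2) (hτ2 : τ ^ 2 = A + C + 2 * D) :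
    ((C + D) / (τ * D) * x + -B / (τ * D) * y) ^ 2
      + (-B / (τ * D) * x + (A + D) / (τ * D) * y) ^ 2
      = (C * x ^ 2 - 2 * B * x * y + A * y ^ 2) / D ^ 2 := by
  field_simp
  rw [hτ2]
  linear_combination (x ^ 2 + y ^ 2) * hD2

/-- Bound on the Lévy-Prokhorov distance of the whitened sketch pair to the standard normal law. -/
lemma IsHashPair.levyProkhorovEDist_whiten_le (hh : IsHashPair P h s) (hm : 0 < m)
    (u v : EuclideanSpace ℝ (Fin d)) (hdet : 0 < ‖u‖ ^ 2 * ‖v‖ ^ 2 - (inner ℝ u v : ℝ) ^ 2)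
    {R η : ℝ} (hη : 0 < η) (hR : ∀ j, u j ^ 2 + v j ^ 2 ≤ R)
    (hRη : 16 * m ^ 2 * (R * (‖u‖ ^ 2 + ‖v‖ ^ 2) /
      (‖u‖ ^ 2 * ‖v‖ ^ 2 - (inner ℝ u v : ℝ) ^ 2)) ≤ η ^ 4) :
    levyProkhorovEDist ((P.map fun ω => sketchPair (fun j => h j ω) (fun j => s j ω) u v).map
        (whiten (covMatrix m u v)))
      (stdGaussian (EuclideanSpace ℝ (Fin m ⊕ Fin m))) ≤ ENNReal.ofReal (10 * η) := by
  have hAs : ‖u‖ ^ 2 = ∑ j, u j ^ 2 := EuclideanSpace.real_norm_sq_eq u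
  have hCs : ‖v‖ ^ 2 = ∑ j, v j ^ 2 := EuclideanSpace.real_norm_sq_eq v
  have hBs : (inner ℝ u v : ℝ) = ∑ j, u j * v j := by
    rw [PiLp.inner_apply]
    exact Finset.sum_congr rfl fun j _ => by simp [mul_comm]
  have hA : 0 ≤ ‖u‖ ^ 2 := by positivity
  have hC : 0 ≤ ‖v‖ ^ 2 := by positivity
  rw [covMatrix_eq_blockCov]
  set A := ‖u‖ ^ 2
  set C := ‖v‖ ^ 2
  set B : ℝ := inner ℝ u v
  have hD : 0 < √(A * C - B ^ 2) := Real.sqrt_pos.2 hdet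
  have hD2 : √(A * C - B ^ 2) ^ 2 = A * C - B ^ 2 := Real.sq_sqrt hdet.le
  generalize √(A * C - B ^ 2) = D at hD hD2
  have hτ : 0 < √(A + C + 2 * D) := Real.sqrt_pos.2 (by positivity)
  have hτ2 : √(A + C + 2 * D) ^ 2 = A + C + 2 * D := Real.sq_sqrt (by positivity)
  generalize √(A + C + 2 * D) = τ at hτ hτ2
  obtain ⟨h1, h2, h3⟩ := sum_orthonormalized u v hD hτ hD2 hτ2 hAs hBs hCs
  rw [hh.map_whiten hm u v hA hC hD hτ hD2 hτ2]
  refine levyProkhorovEDist_sketch_le hm P _ (hh.measurable_sketchTerm _ _)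
    (hh.iIndepFun_sketchTerm _ _) _ _ (hh.isSketchStep _ _) h1 h2 h3 hη (fun j => ?_) hRη
  rw [sq_add_sq_orthonormalized _ _ hD hτ hD2 hτ2, hD2]
  gcongr
  -- The form `C x² - 2Bxy + A y²` falls short of `(A + C)(x² + y²)` by `A x² + 2Bxy + C y²`, which
  -- is nonnegative.
  have h1 := nonnegForm_of_det_pos hA hdet (u j) (v j)
  have h2 : (u j ^ 2 + v j ^ 2) * (A + C) ≤ R * (A + C) := by gcongr; exact hR j
  nlinarith

end HashPair

/-! ### Moment conditions and the limit for deterministic vectors -/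

section Asymptotics

/-- The moment and determinant conditions bound the squared lengths of the whitened coordinates. -/
lemma le_rpow_of_moment {d : ℕ} (hd : 0 < d) {δ : ℝ} (hδ : 0 < δ) (u v : EuclideanSpace ℝ (Fin d))
    {C c : ℝ} (hc : 0 < c)
    (hC : (1 / (d : ℝ)) * ∑ j, ((u j) ^ 2 + (v j) ^ 2) ^ ((2 + δ) / 2) ≤ C)
    (hdet : c ≤ (‖u‖ ^ 2 * ‖v‖ ^ 2 - (inner ℝ u v : ℝ) ^ 2) / (d : ℝ) ^ 2) :
    0 < ‖u‖ ^ 2 * ‖v‖ ^ 2 - (inner ℝ u v : ℝ) ^ 2 ∧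
    (∀ j, u j ^ 2 + v j ^ 2 ≤ (C * d) ^ (2 / (2 + δ))) ∧
    (C * d) ^ (2 / (2 + δ)) * (‖u‖ ^ 2 + ‖v‖ ^ 2) / (‖u‖ ^ 2 * ‖v‖ ^ 2 - (inner ℝ u v : ℝ) ^ 2)
      ≤ C ^ (2 / (2 + δ)) * (1 + C) / c * (((d : ℝ) ^ (δ / (2 * (2 + δ)))) ^ 2)⁻¹ := by
  have hd0 : (0 : ℝ) < d := by exact_mod_cast hd
  have hS0 : ∀ j, 0 ≤ u j ^ 2 + v j ^ 2 := fun j => by positivity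
  have hF0 : ∀ j, 0 ≤ (u j ^ 2 + v j ^ 2) ^ ((2 + δ) / 2) := fun j => by positivity
  have hsum : ∑ j, (u j ^ 2 + v j ^ 2) ^ ((2 + δ) / 2) ≤ C * d := by
    rw [one_div, inv_mul_le_iff₀ hd0] at hC; linarith
  have hC0 : 0 ≤ C := le_trans (mul_nonneg (by positivity) (Finset.sum_nonneg fun j _ => hF0 j)) hC
  have hdet' : c * d ^ 2 ≤ ‖u‖ ^ 2 * ‖v‖ ^ 2 - (inner ℝ u v : ℝ) ^ 2 := by
    rwa [le_div_iff₀ (by positivity)] at hdet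
  have hdpos : 0 < ‖u‖ ^ 2 * ‖v‖ ^ 2 - (inner ℝ u v : ℝ) ^ 2 := lt_of_lt_of_le (by positivity) hdet'
  refine ⟨hdpos, fun j => ?_, ?_⟩
  · have h1 : (u j ^ 2 + v j ^ 2) ^ ((2 + δ) / 2) ≤ C * d :=
      (Finset.single_le_sum (fun j _ => hF0 j) (Finset.mem_univ j)).trans hsum
    have h2 := Real.rpow_le_rpow (hF0 j) h1 (by positivity : 0 ≤ 2 / (2 + δ))
    rwa [← Real.rpow_mul (hS0 j), div_mul_div_comm, mul_comm (2 + δ), div_self (by positivity),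
      Real.rpow_one] at h2
  · have hT : ‖u‖ ^ 2 + ‖v‖ ^ 2 ≤ (1 + C) * d := by
      rw [EuclideanSpace.real_norm_sq_eq, EuclideanSpace.real_norm_sq_eq, ← Finset.sum_add_distrib]
      have h1 : ∀ j, u j ^ 2 + v j ^ 2 ≤ 1 + (u j ^ 2 + v j ^ 2) ^ ((2 + δ) / 2) := by
        intro j
        rcases le_total (u j ^ 2 + v j ^ 2) 1 with h | h
        · linarith [hF0 j]
        · have := Real.rpow_le_rpow_of_exponent_le h (by linarith : (1 : ℝ) ≤ (2 + δ) / 2)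
          rw [Real.rpow_one] at this; linarith
      refine (Finset.sum_le_sum fun j _ => h1 j).trans ?_
      rw [Finset.sum_add_distrib]
      simp only [Finset.sum_const, Finset.card_univ, Fintype.card_fin, nsmul_eq_mul, mul_one]
      linarith
    -- The maximal coordinate is of order `d^{2/(2+δ)}`, the trace `d` and the determinant `d²`. The
    -- resulting exponent `2/(2+δ) - 1 = -δ/(2+δ)` is minus twice the one allowed for `m`.
    have hpow : (((d : ℝ) ^ (δ / (2 * (2 + δ)))) ^ 2)⁻¹ = (d : ℝ) ^ (2 / (2 + δ)) / d := by
      rw [← Real.rpow_natCast, ← Real.rpow_mul hd0.le, ← Real.rpow_neg hd0.le,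
        ← Real.rpow_sub_one hd0.ne']
      congr 1
      field_simp
      push_cast; ring
    calc (C * d) ^ (2 / (2 + δ)) * (‖u‖ ^ 2 + ‖v‖ ^ 2) /
          (‖u‖ ^ 2 * ‖v‖ ^ 2 - (inner ℝ u v : ℝ) ^ 2)
        ≤ (C * d) ^ (2 / (2 + δ)) * ((1 + C) * d) / (c * d ^ 2) := by gcongr
      _ = _ := by
        rw [hpow, Real.mul_rpow hC0 hd0.le]
        field_simp

lemma posDef_covMatrix {d m : ℕ} (hm : 0 < m) (u v : EuclideanSpace ℝ (Fin d))
    (hdet : 0 < ‖u‖ ^ 2 * ‖v‖ ^ 2 - (inner ℝ u v : ℝ) ^ 2) : (covMatrix m u v).PosDef := by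
  have hm0 : (0 : ℝ) < m := by exact_mod_cast hm
  rw [covMatrix_eq_blockCov]
  refine posDef_blockCov (by positivity) ?_
  rw [div_mul_div_comm, div_pow, ← pow_two, ← sub_div]
  positivity

variable {δ : ℝ} {m : ℕ → ℕ} {Ω : ℕ → Type*} [∀ d, MeasurableSpace (Ω d)]
  {P : ∀ d, Measure (Ω d)} [∀ d, IsProbabilityMeasure (P d)]
  {h : ∀ d, Fin d → Ω d → Fin (m d)} {s : ∀ d, Fin d → Ω d → ℤˣ}

/-- Asymptotic normality of the count-sketch for deterministic vectors. -/
lemma asymptoticallyNormal_of_moment (hδ : 0 < δ) (hm_pos : ∀ d, 0 < m d)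
    (hm : (fun d => (m d : ℝ)) =o[atTop] fun d : ℕ => (d : ℝ) ^ (δ / (2 * (2 + δ))))
    (hhs : ∀ d, IsHashPair (P d) (h d) (s d))
    (u v : ∀ d : ℕ, EuclideanSpace ℝ (Fin d)) {C c : ℝ} (hc : 0 < c)
    (hC : ∀ᶠ d : ℕ in atTop,
      (1 / (d : ℝ)) * ∑ j, ((u d j) ^ 2 + (v d j) ^ 2) ^ ((2 + δ) / 2) ≤ C)
    (hdet : ∀ᶠ d : ℕ in atTop,
      c ≤ (‖u d‖ ^ 2 * ‖v d‖ ^ 2 - (inner ℝ (u d) (v d)) ^ 2) / (d : ℝ) ^ 2) :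
    AsymptoticallyNormal
      (fun d => (P d).map fun ω => sketchPair (fun j => h d j ω) (fun j => s d j ω) (u d) (v d))
      (fun d => covMatrix (m d) (u d) (v d)) := by
  refine ⟨?_, ENNReal.tendsto_nhds_zero.2 fun ε hε => ?_⟩
  · filter_upwards [hC, hdet, eventually_gt_atTop 0] with d h1 h2 h3
    exact posDef_covMatrix (hm_pos d) _ _ (le_rpow_of_moment h3 hδ _ _ hc h1 h2).1
  obtain ⟨r, hr0, hrε⟩ := ENNReal.lt_iff_exists_nnreal_btwn.1 hε
  have hr : 0 < (r : ℝ) / 10 := by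
    have : 0 < r := by exact_mod_cast hr0
    positivity
  have hlim : Tendsto (fun d : ℕ => 16 * (C ^ (2 / (2 + δ)) * (1 + C) / c) *
      ((m d : ℝ) / (d : ℝ) ^ (δ / (2 * (2 + δ)))) ^ 2) atTop (𝓝 0) := by
    simpa using (hm.tendsto_div_nhds_zero.pow 2).const_mul
      (16 * (C ^ (2 / (2 + δ)) * (1 + C) / c))
  filter_upwards [hC, hdet, eventually_gt_atTop 0,
    hlim.eventually (eventually_le_nhds (show 0 < ((r : ℝ) / 10) ^ 4 by positivity))]
    with d h1 h2 h3 h4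
  obtain ⟨hpos, hR, hρ⟩ := le_rpow_of_moment h3 hδ _ _ hc h1 h2
  refine ((hhs d).levyProkhorovEDist_whiten_le (hm_pos d) _ _ hpos hr hR ?_).trans ?_
  · refine le_trans (le_trans (mul_le_mul_of_nonneg_left hρ (by positivity)) (le_of_eq ?_)) h4
    rw [div_pow]; ring
  · rw [mul_div_cancel₀ _ (by norm_num : (10 : ℝ) ≠ 0), ENNReal.ofReal_coe_nnreal]
    exact hrε.le

end Asymptotics

/-! ### Strong law for i.i.d. coordinate pairs -/

section Random

variable {Ω' : Type*} [MeasurableSpace Ω'] {Q : Measure Ω'} {U V : ℕ → Ω' → ℝ}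

/-- Strong law of large numbers for functions of i.i.d. pairs. -/
lemma ae_tendsto_average_pair (hind : iIndepFun (fun j ω => (U j ω, V j ω)) Q)
    (hid : ∀ j, IdentDistrib (fun ω => (U j ω, V j ω)) (fun ω => (U 0 ω, V 0 ω)) Q Q)
    {φ : ℝ × ℝ → ℝ} (hφ : Measurable φ) (hint : Integrable (fun ω => φ (U 0 ω, V 0 ω)) Q) :
    ∀ᵐ ω ∂Q, Tendsto (fun d : ℕ => (1 / (d : ℝ)) * ∑ j : Fin d, φ (U j ω, V j ω)) atTop
      (𝓝 (∫ ω, φ (U 0 ω, V 0 ω) ∂Q)) := by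
  have h := strong_law_ae_real (fun j ω => φ (U j ω, V j ω)) hint
    (fun i j hij => (hind.indepFun hij).comp hφ hφ) (fun j => (hid j).comp hφ)
  filter_upwards [h] with ω hω
  refine hω.congr fun d => ?_
  rw [Fin.sum_univ_eq_sum_range (fun j => φ (U j ω, V j ω)) d, one_div, div_eq_inv_mul]

lemma integrable_sq_add_sq_of_rpow [IsProbabilityMeasure Q] {X Y : Ω' → ℝ} (hX : Measurable X)
    (hY : Measurable Y) {δ : ℝ} (hδ : 0 < δ)
    (hint : Integrable (fun ω => (X ω ^ 2 + Y ω ^ 2) ^ ((2 + δ) / 2)) Q) :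
    Integrable (fun ω => X ω ^ 2 + Y ω ^ 2) Q := by
  refine ((integrable_const (1 : ℝ)).add hint).mono' (by fun_prop) (ae_of_all _ fun ω => ?_)
  have h0 : 0 ≤ X ω ^ 2 + Y ω ^ 2 := by positivity
  have h1 : 0 ≤ (X ω ^ 2 + Y ω ^ 2) ^ ((2 + δ) / 2) := by positivity
  rw [Real.norm_of_nonneg h0, Pi.add_apply]
  rcases le_total (X ω ^ 2 + Y ω ^ 2) 1 with h | h
  · linarith
  · have := Real.rpow_le_rpow_of_exponent_le h (by linarith : (1 : ℝ) ≤ (2 + δ) / 2)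
    rw [Real.rpow_one] at this; linarith

end Random

end CountSketch

theorem mainTheorem10
    (δ : ℝ) (hδ : 0 < δ)
    (m : ℕ → ℕ) (hm_pos : ∀ d, 0 < m d)
    (hm : (fun d => (m d : ℝ)) =o[atTop] fun d : ℕ => (d : ℝ) ^ (δ / (2 * (2 + δ))))
    {Ω : ℕ → Type*} [∀ d, MeasurableSpace (Ω d)]
    (P : ∀ d, Measure (Ω d)) [∀ d, IsProbabilityMeasure (P d)]
    (h : ∀ d, Fin d → Ω d → Fin (m d)) (s : ∀ d, Fin d → Ω d → ℤˣ)
    (hhs : ∀ d, CountSketch.IsHashPair (P d) (h d) (s d)) :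
    -- deterministic vectors, the expectation being the average over the coordinates
    (∀ (u v : ∀ d : ℕ, EuclideanSpace ℝ (Fin d)) (C c : ℝ), 0 < c →
      (∀ᶠ d : ℕ in atTop,
        (1 / (d : ℝ)) * ∑ j, ((u d j) ^ 2 + (v d j) ^ 2) ^ ((2 + δ) / 2) ≤ C) →
      (∀ᶠ d : ℕ in atTop,
        c ≤ (‖u d‖ ^ 2 * ‖v d‖ ^ 2 - (inner ℝ (u d) (v d)) ^ 2) / (d : ℝ) ^ 2) →
      CountSketch.AsymptoticallyNormal
        (fun d => (P d).map fun ω =>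
          CountSketch.sketchPair (fun j => h d j ω) (fun j => s d j ω) (u d) (v d))
        (fun d => CountSketch.covMatrix (m d) (u d) (v d))) ∧
    -- vectors with i.i.d. random coordinate pairs, for almost every realization of them
    (∀ {Ω' : Type*} [MeasurableSpace Ω'] (Q : Measure Ω') [IsProbabilityMeasure Q]
      (U V : ℕ → Ω' → ℝ), (∀ j, Measurable (U j)) → (∀ j, Measurable (V j)) →
      iIndepFun (fun j ω => (U j ω, V j ω)) Q →
      (∀ j, IdentDistrib (fun ω => (U j ω, V j ω)) (fun ω => (U 0 ω, V 0 ω)) Q Q) →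
      (∀ j, Integrable (fun ω => ((U j ω) ^ 2 + (V j ω) ^ 2) ^ ((2 + δ) / 2)) Q) →
      (∫ ω, U 0 ω * V 0 ω ∂Q) ^ 2 < (∫ ω, (U 0 ω) ^ 2 ∂Q) * (∫ ω, (V 0 ω) ^ 2 ∂Q) →
      ∀ᵐ ω' ∂Q, CountSketch.AsymptoticallyNormal
        (fun d => (P d).map fun ω =>
          CountSketch.sketchPair (fun j => h d j ω) (fun j => s d j ω)
            (WithLp.toLp 2 fun j : Fin d => U j ω') (WithLp.toLp 2 fun j : Fin d => V j ω'))
        (fun d => CountSketch.covMatrix (m d)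
          (WithLp.toLp 2 fun j : Fin d => U j ω') (WithLp.toLp 2 fun j : Fin d => V j ω'))) := by
  refine ⟨fun u v C c hc hC hdet =>
    CountSketch.asymptoticallyNormal_of_moment hδ hm_pos hm hhs u v hc hC hdet, ?_⟩
  intro Ω' _ Q _ U V hU hV hind hid hint hlt
  have hS := CountSketch.integrable_sq_add_sq_of_rpow (hU 0) (hV 0) hδ (hint 0)
  have hUm := hU 0
  have hVm := hV 0
  have iU : Integrable (fun ω => U 0 ω ^ 2) Q :=
    hS.mono' (by fun_prop) (ae_of_all _ fun ω => by
      rw [Real.norm_of_nonneg (sq_nonneg _)]; linarith [sq_nonneg (V 0 ω)])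
  have iV : Integrable (fun ω => V 0 ω ^ 2) Q :=
    hS.mono' (by fun_prop) (ae_of_all _ fun ω => by
      rw [Real.norm_of_nonneg (sq_nonneg _)]; linarith [sq_nonneg (U 0 ω)])
  have iUV : Integrable (fun ω => U 0 ω * V 0 ω) Q :=
    hS.mono' (by fun_prop) (ae_of_all _ fun ω => by
      rw [Real.norm_eq_abs]
      exact abs_le.2 ⟨by nlinarith [sq_nonneg (U 0 ω + V 0 ω), sq_nonneg (U 0 ω), sq_nonneg (V 0 ω)],
        by nlinarith [sq_nonneg (U 0 ω - V 0 ω), sq_nonneg (U 0 ω), sq_nonneg (V 0 ω)]⟩)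
  filter_upwards [
    CountSketch.ae_tendsto_average_pair hind hid
      (φ := fun x => (x.1 ^ 2 + x.2 ^ 2) ^ ((2 + δ) / 2)) (by fun_prop) (hint 0),
    CountSketch.ae_tendsto_average_pair hind hid (φ := fun x => x.1 ^ 2) (by fun_prop) iU,
    CountSketch.ae_tendsto_average_pair hind hid (φ := fun x => x.2 ^ 2) (by fun_prop) iV,
    CountSketch.ae_tendsto_average_pair hind hid (φ := fun x => x.1 * x.2) (by fun_prop) iUV]
    with ω h1 h2 h3 h4
  have hlim := (h2.mul h3).sub (h4.pow 2)
  -- The normalized determinant converges almost surely to a positive limit, so any smaller positive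
  -- `c` is eventually a lower bound. The moment averages are likewise eventually below their limit
  -- plus `1`.
  obtain ⟨c, hc0, hc1⟩ := exists_between (sub_pos.2 hlt)
  refine CountSketch.asymptoticallyNormal_of_moment hδ hm_pos hm hhs _ _ hc0
    (h1.eventually (eventually_le_nhds (lt_add_one _))) ?_
  filter_upwards [hlim.eventually (eventually_ge_nhds hc1)] with d hd
  refine hd.trans (le_of_eq ?_)
  rw [EuclideanSpace.real_norm_sq_eq, EuclideanSpace.real_norm_sq_eq, PiLp.inner_apply]
  simp only [RCLike.inner_apply, conj_trivial, mul_comm (V _ ω)]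
  ring
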